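/- **Conventions.** Graphs are finite, undirected and simple. A *matching cut* of a graph $G$ is a (possibly empty) set of edges $M$ that is a matching and satisfies $M=E_G(A,B)$ for some partition $\{A,B\}$ of $V(G)$ into two nonempty sets; it is *minimal* (*maximal*) if no matching cut of $G$ is properly contained in $M$ (properly contains $M$). A *neighborhood decomposition* of $G$ is a partition of $V(G)$ into nonempty modules, each of which is a clique or an independent set; the *neighborhood diversity* $\mathsf{nd}(G)$ is the minimum number of parts of such a partition. *Enum MC*, *Enum Minimal MC* and *Enum Maximal MC* ask to list all matching cuts, all minimal matching cuts and all maximal matching cuts of an input graph. Instances and solutions are binary words: a graph on $\{0,\dots,n-1\}$ is given by its $n\times n$ adjacency matrix, and a set of edges by the adjacency matrix of the graph with these edges; a word $x$ that encodes no graph has no solutions. The parameter is $\kappa(x)=\mathsf{nd}(G)$ if $x$ encodes $G$, and $\kappa(x)=0$ if $x$ encodes no graph. Algorithms are deterministic random access machine programs with addition and truncated subtraction as arithmetic operations, under unit cost. For a problem with solution sets $\mathsf{Sol}(x)$ and parameter $\kappa(x)$, a *fully-polynomial enumeration kernel* is a pair of algorithms $\mathcal A,\mathcal A'$ such that 1.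 for every instance $x$, $\mathcal A$ computes, in time polynomial in $|x|+\kappa(x)$, an instance $y$ with $|y|+\kappa(y)\le f(\kappa(x))$, where $f$ is a computable function; 2. for every $s\in\mathsf{Sol}(y)$, $\mathcal A'$ on input $(x,y,s)$ lists without repetitions, in time polynomial in $|x|+|y|+\kappa(x)+\kappa(y)$, a nonempty set $S_s\subseteq\mathsf{Sol}(x)$, such that the sets $S_s$, $s\in\mathsf{Sol}(y)$, are pairwise disjoint and have union $\mathsf{Sol}(x)$. A *polynomial-delay enumeration kernel* is defined in the same way, except that in 2. the algorithm $\mathcal A'$ always terminates and lists $S_s$ with delay polynomial in $|x|+|y|+\kappa(x)+\kappa(y)$ (the time before the first output, between consecutive outputs, and after the last output). **Theorem.** Parameterized by the neighborhood diversity $k$ of the input graph, Enum Minimal MC admits a fully-polynomial enumeration kernel, and Enum MC and Enum Maximal MC admit polynomial-delay enumeration kernels. In each of the three kernels, for every input graph $G$ with $k=\mathsf{nd}(G)$, the instance computed by $\mathcal A$ encodes a graph with at most $3k$ vertices. -/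

import Mathlib

namespace EnumKernel

/-! ### Matching cuts and neighborhood diversity -/

section Graphs

variable {V : Type*}

/-- The set `E_G(A, B)` of edges of `G` with one end in `A` and the other in `B`. -/
def edgesBetween (G : SimpleGraph V) (A B : Set V) : Set (Sym2 V) :=
  {e | ∃ u ∈ A, ∃ v ∈ B, G.Adj u v ∧ e = s(u, v)}

/-- `M` is an edge cut: `M = E_G(A, B)` for a partition `{A, B}` of the vertex set
(both parts are nonempty; `M` itself may be empty). -/
def IsEdgeCut (G : SimpleGraph V) (M : Set (Sym2 V)) : Prop :=
  ∃ A B : Set V, A.Nonempty ∧ B.Nonempty ∧ Disjoint A B ∧ A ∪ B = Set.univ ∧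
    M = edgesBetween G A B

/-- No two distinct edges of `M` share an end-vertex. -/
def IsMatchingSet (M : Set (Sym2 V)) : Prop :=
  ∀ e ∈ M, ∀ f ∈ M, ∀ v : V, v ∈ e → v ∈ f → e = f

/-- A matching cut is a (possibly empty) set of edges that is an edge cut and a matching. -/
def IsMatchingCut (G : SimpleGraph V) (M : Set (Sym2 V)) : Prop :=
  IsEdgeCut G M ∧ IsMatchingSet M

/-- Inclusion-minimal matching cuts. -/
def IsMinimalMatchingCut (G : SimpleGraph V) (M : Set (Sym2 V)) : Prop :=
  IsMatchingCut G M ∧ ∀ M', IsMatchingCut G M' → ¬ M' ⊂ M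

/-- Inclusion-maximal matching cuts. -/
def IsMaximalMatchingCut (G : SimpleGraph V) (M : Set (Sym2 V)) : Prop :=
  IsMatchingCut G M ∧ ∀ M', IsMatchingCut G M' → ¬ M ⊂ M'

/-- `U` is a module: every vertex outside `U` is adjacent to all of `U` or to none of `U`. -/
def IsModule (G : SimpleGraph V) (U : Finset V) : Prop :=
  ∀ v, v ∉ U → (∀ u ∈ U, G.Adj v u) ∨ (∀ u ∈ U, ¬ G.Adj v u)

/-- A neighborhood decomposition: a partition of the vertex set into (nonempty) modules, each of
which is a clique or an independent set. -/
def IsNeighborhoodDecomposition [Fintype V] [DecidableEq V] (G : SimpleGraph V)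
    (P : Finpartition (Finset.univ : Finset V)) : Prop :=
  ∀ U ∈ P.parts, IsModule G U ∧ (G.IsClique (U : Set V) ∨ G.IsIndepSet (U : Set V))

/-- The neighborhood diversity: the minimum size of a neighborhood decomposition. (The partition
into singletons is one, so the minimum is over a nonempty set.) -/
noncomputable def neighborhoodDiversity [Fintype V] [DecidableEq V] (G : SimpleGraph V) : ℕ :=
  sInf {k | ∃ P : Finpartition (Finset.univ : Finset V),
    IsNeighborhoodDecomposition G P ∧ P.parts.card = k}

end Graphs

/-! ### The machine model

Algorithms are programs of a random access machine with structured control flow. A state has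
registers and arrays that hold natural numbers, and a buffer for the word that is being written.
The arithmetic operations are addition and truncated subtraction (there is no multiplication), so
that the unit-cost measure is polynomially related to the running time of Turing machines. -/

/-- Expressions. The index in `reg` and `get` is the fixed name of a register or an array. -/
inductive Expr : Type
  | const : ℕ → Expr
  | reg : ℕ → Expr
  | get : ℕ → Expr → Expr
  | add : Expr → Expr → Expr
  | sub : Expr → Expr → Expr
  | eq : Expr → Expr → Expr
  | lt : Expr → Expr → Expr

/-- Programs. -/
inductive Prog : Type
  /-- do nothing -/
  | skip : Prog
  /-- assign the value of an expression to a register -/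
  | assign : ℕ → Expr → Prog
  /-- `store a i e` writes the value of `e` into cell `i` of array `a` -/
  | store : ℕ → Expr → Expr → Prog
  /-- append a bit to the buffer (`0` is the bit false, other numbers are the bit true) -/
  | write : Expr → Prog
  /-- output the word in the buffer and clear the buffer -/
  | emit : Prog
  /-- sequential composition -/
  | seq : Prog → Prog → Prog
  /-- case distinction on whether the value of an expression is nonzero -/
  | cond : Expr → Prog → Prog → Prog
  /-- repeat the body as long as the value of an expression is nonzero -/
  | loop : Expr → Prog → Prog

/-- Machine states. -/
structure State : Type where
  reg : ℕ → ℕ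
  arr : ℕ → ℕ → ℕ
  buf : List Bool

/-- The value of an expression; comparisons have value `1` (true) or `0` (false). -/
def Expr.eval (σ : State) : Expr → ℕ
  | const c => c
  | reg i => σ.reg i
  | get a e => σ.arr a (e.eval σ)
  | add e e' => e.eval σ + e'.eval σ
  | sub e e' => e.eval σ - e'.eval σ
  | eq e e' => if e.eval σ = e'.eval σ then 1 else 0
  | lt e e' => if e.eval σ < e'.eval σ then 1 else 0

/-- Set register `i` to `v`. -/
def State.setReg (σ : State) (i v : ℕ) : State :=
  { σ with reg := Function.update σ.reg i v }

/-- Set cell `i` of array `a` to `v`. -/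
def State.setArr (σ : State) (a i v : ℕ) : State :=
  { σ with arr := Function.update σ.arr a (Function.update (σ.arr a) i v) }

/-- The trace of a computation lists its steps in order: `none` is a step without output,
`some w` is a step that outputs the word `w`. -/
abbrev Trace : Type := List (Option (List Bool))

/-- `Exec c σ σ' tr`: started in state `σ`, the program `c` terminates in state `σ'`, and `tr` is
the trace of the computation. Every elementary command and every evaluation of a test takes one
step. -/
inductive Exec : Prog → State → State → Trace → Prop
  | skip (σ) : Exec .skip σ σ [none]
  | assign (σ i e) : Exec (.assign i e) σ (σ.setReg i (e.eval σ)) [none]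
  | store (σ a i e) : Exec (.store a i e) σ (σ.setArr a (i.eval σ) (e.eval σ)) [none]
  | write (σ e) :
      Exec (.write e) σ { σ with buf := σ.buf ++ [decide (e.eval σ ≠ 0)] } [none]
  | emit (σ) : Exec .emit σ { σ with buf := [] } [some σ.buf]
  | seq {c d σ σ' σ'' tr tr'} : Exec c σ σ' tr → Exec d σ' σ'' tr' →
      Exec (.seq c d) σ σ'' (tr ++ tr')
  | cond_true {e c d σ σ' tr} : e.eval σ ≠ 0 → Exec c σ σ' tr →
      Exec (.cond e c d) σ σ' (none :: tr)
  | cond_false {e c d σ σ' tr} : e.eval σ = 0 → Exec d σ σ' tr →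
      Exec (.cond e c d) σ σ' (none :: tr)
  | loop_done {e c σ} : e.eval σ = 0 → Exec (.loop e c) σ σ [none]
  | loop_step {e c σ σ' σ'' tr tr'} : e.eval σ ≠ 0 → Exec c σ σ' tr →
      Exec (.loop e c) σ' σ'' tr' → Exec (.loop e c) σ σ'' (none :: (tr ++ tr'))

/-- Programs are deterministic: final state and trace are determined by the initial state. -/
theorem Exec.deterministic {c : Prog} {σ σ₁ σ₂ : State} {t₁ t₂ : Trace}
    (h₁ : Exec c σ σ₁ t₁) (h₂ : Exec c σ σ₂ t₂) : σ₁ = σ₂ ∧ t₁ = t₂ := by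
  induction h₁ generalizing σ₂ t₂ with
  | skip | assign | store | write | emit => cases h₂; exact ⟨rfl, rfl⟩
  | seq _ _ ih ih' =>
    cases h₂ with
    | seq a b => obtain ⟨rfl, rfl⟩ := ih a; obtain ⟨rfl, rfl⟩ := ih' b; exact ⟨rfl, rfl⟩
  | cond_true h _ ih =>
    cases h₂ with
    | cond_true _ a => obtain ⟨rfl, rfl⟩ := ih a; exact ⟨rfl, rfl⟩
    | cond_false h' _ => exact absurd h' h
  | cond_false h _ ih =>
    cases h₂ with
    | cond_true h' _ => exact absurd h h'
    | cond_false _ a => obtain ⟨rfl, rfl⟩ := ih a; exact ⟨rfl, rfl⟩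
  | loop_done h =>
    cases h₂ with
    | loop_done _ => exact ⟨rfl, rfl⟩
    | loop_step h' _ _ => exact absurd h h'
  | loop_step h _ _ ih ih' =>
    cases h₂ with
    | loop_done h' => exact absurd h' h
    | loop_step _ a b => obtain ⟨rfl, rfl⟩ := ih a; obtain ⟨rfl, rfl⟩ := ih' b; exact ⟨rfl, rfl⟩

/-- The initial state for a list of input words: register `j` holds the length of the `j`-th word
and array `j` holds its bits; everything else is `0`. -/
def initState (inp : List (List Bool)) : State where
  reg j := (inp.getD j []).length
  arr j i := if (inp.getD j []).getD i false then 1 else 0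
  buf := []

/-- On the given input words, the program terminates and its computation has trace `tr`. -/
def RunsWith (c : Prog) (inp : List (List Bool)) (tr : Trace) : Prop :=
  ∃ σ, Exec c (initState inp) σ tr

/-- The words that are output, in order. -/
def outputs (tr : Trace) : List (List Bool) := tr.filterMap id

/-- The computation takes at most `t` steps. -/
def TimeLE (tr : Trace) (t : ℕ) : Prop := tr.length ≤ t

/-- All delays are at most `t`: any run of consecutive steps without output (before the first
output, between two outputs, or after the last output) has length at most `t`. -/
def DelayLE (tr : Trace) (t : ℕ) : Prop :=
  ∀ pre mid post : Trace, tr = pre ++ mid ++ post → (∀ e ∈ mid, e = none) → mid.length ≤ t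

/-! ### Parameterized enumeration problems and enumeration kernels -/

/-- A parameterized enumeration problem over the alphabet `Bool`: every word `x` is an instance,
with the finite set `Sol x` of solutions and the parameter `κ x`. The language `L` of the problem
is `{x | Sol x ≠ ∅}`. -/
structure ParamEnumProblem : Type where
  Sol : List Bool → Set (List Bool)
  finite_sol : ∀ x, (Sol x).Finite
  κ : List Bool → ℕ

/-- The pair of a kernelization algorithm `A` and a solution-lifting algorithm `A'` is an
enumeration kernel, where `Cost tr t` expresses that the computation `tr` of the solution-lifting
algorithm is within the bound `t`. The algorithm `A'` has the input `x, y, s` and lists the set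
`S s` without repetitions. The nonempty sets `S s`, `s ∈ Sol y`, partition `Sol x`. -/
def IsEnumKernel (Cost : Trace → ℕ → Prop) (Q : ParamEnumProblem) (A A' : Prog) : Prop :=
  ∃ (p q : Polynomial ℕ) (f : ℕ → ℕ), Computable f ∧ ∀ x : List Bool, ∃ y : List Bool,
    (∃ tr, RunsWith A [x] tr ∧ outputs tr = [y] ∧ TimeLE tr (p.eval (x.length + Q.κ x))) ∧
    y.length + Q.κ y ≤ f (Q.κ x) ∧
    ∃ S : List Bool → Set (List Bool),
      (∀ s ∈ Q.Sol y, ∃ tr, RunsWith A' [x, y, s] tr ∧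
        Cost tr (q.eval (x.length + y.length + Q.κ x + Q.κ y)) ∧
        (outputs tr).Nodup ∧ {w | w ∈ outputs tr} = S s) ∧
      (∀ s ∈ Q.Sol y, (S s).Nonempty) ∧
      (Q.Sol y).PairwiseDisjoint S ∧
      ⋃ s ∈ Q.Sol y, S s = Q.Sol x

/-- Fully-polynomial enumeration kernels: the solution-lifting algorithm runs in polynomial
time. -/
def IsFullyPolynomialEnumKernel (Q : ParamEnumProblem) (A A' : Prog) : Prop :=
  IsEnumKernel TimeLE Q A A'

/-- Polynomial-delay enumeration kernels: the solution-lifting algorithm has polynomial delay. -/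
def IsPolynomialDelayEnumKernel (Q : ParamEnumProblem) (A A' : Prog) : Prop :=
  IsEnumKernel DelayLE Q A A'

/-! ### The matching cut problems -/

/-- The word of length `n ^ 2` that lists an `n × n` bit matrix row by row. -/
def encodeMatrix {n : ℕ} (r : Fin n → Fin n → Bool) : List Bool :=
  List.ofFn fun t : Fin (n * n) => r t.divNat t.modNat

open Classical in
/-- A graph with vertex set `Fin n` is encoded by its adjacency matrix. -/
noncomputable def encodeGraph {n : ℕ} (G : SimpleGraph (Fin n)) : List Bool :=
  encodeMatrix fun i j => decide (G.Adj i j)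

open Classical in
/-- A set of edges is encoded by the adjacency matrix of the graph with these edges. -/
noncomputable def encodeEdges {n : ℕ} (M : Set (Sym2 (Fin n))) : List Bool :=
  encodeMatrix fun i j => decide (s(i, j) ∈ M)

theorem encodeMatrix_injective {n : ℕ} {r r' : Fin n → Fin n → Bool}
    (h : encodeMatrix r = encodeMatrix r') : r = r' := by
  have h' := List.ofFn_injective h
  funext i j
  have := congrFun h' (finProdFinEquiv (i, j))
  have e := finProdFinEquiv.symm_apply_apply (i, j)
  rw [finProdFinEquiv_symm_apply, Prod.mk.injEq] at e
  simpa only [e.1, e.2] using this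

/-- Different graphs have different encodings. -/
theorem encodeGraph_injective {n m : ℕ} {G : SimpleGraph (Fin n)} {H : SimpleGraph (Fin m)}
    (h : encodeGraph G = encodeGraph H) : (⟨n, G⟩ : Σ n, SimpleGraph (Fin n)) = ⟨m, H⟩ := by
  have hl : n * n = m * m := by
    simpa [encodeGraph, encodeMatrix] using congrArg List.length h
  obtain rfl : n = m := Nat.mul_self_inj.mp hl
  have := encodeMatrix_injective h
  congr 1
  ext i j
  simpa using congrFun (congrFun this i) j

/-- Different sets of edges have different encodings. -/
theorem encodeEdges_injective {n : ℕ} {M M' : Set (Sym2 (Fin n))}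
    (h : encodeEdges M = encodeEdges M') : M = M' := by
  have := encodeMatrix_injective h
  ext e
  induction e with
  | _ i j => simpa using congrFun (congrFun this i) j

/-- The solutions to the instance `x` when the edge sets `M` with `IsSol G M` are to be enumerated
for the graph `G` encoded by `x`; there are none if `x` does not encode a graph. -/
def graphSolutions (IsSol : ∀ n, SimpleGraph (Fin n) → Set (Sym2 (Fin n)) → Prop)
    (x : List Bool) : Set (List Bool) :=
  {w | ∃ (n : ℕ) (G : SimpleGraph (Fin n)) (M : Set (Sym2 (Fin n))),
    x = encodeGraph G ∧ IsSol n G M ∧ w = encodeEdges M}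

theorem graphSolutions_finite (IsSol : ∀ n, SimpleGraph (Fin n) → Set (Sym2 (Fin n)) → Prop)
    (x : List Bool) : (graphSolutions IsSol x).Finite := by
  refine (List.finite_length_eq Bool x.length).subset ?_
  rintro w ⟨n, G, M, rfl, -, rfl⟩
  simp [encodeGraph, encodeEdges, encodeMatrix]

open Classical in
/-- The parameter of the instance `x`: the neighborhood diversity of the graph encoded by `x`
(and `0` if `x` does not encode a graph). -/
noncomputable def ndParameter (x : List Bool) : ℕ :=
  if h : ∃ g : Σ n, SimpleGraph (Fin n), x = encodeGraph g.2 then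
    neighborhoodDiversity h.choose.2 else 0

theorem ndParameter_encodeGraph {n : ℕ} (G : SimpleGraph (Fin n)) :
    ndParameter (encodeGraph G) = neighborhoodDiversity G := by
  have h : ∃ g : Σ n, SimpleGraph (Fin n), encodeGraph G = encodeGraph g.2 := ⟨⟨n, G⟩, rfl⟩
  have e : (⟨n, G⟩ : Σ n, SimpleGraph (Fin n)) = h.choose := encodeGraph_injective h.choose_spec
  rw [ndParameter, dif_pos h, ← e]

/-- The enumeration of all matching cuts, parameterized by the neighborhood diversity. -/
noncomputable def enumMC : ParamEnumProblem where
  Sol := graphSolutions fun _ G M => IsMatchingCut G M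
  finite_sol := graphSolutions_finite _
  κ := ndParameter

/-- The enumeration of all minimal matching cuts, parameterized by the neighborhood diversity. -/
noncomputable def enumMinimalMC : ParamEnumProblem where
  Sol := graphSolutions fun _ G M => IsMinimalMatchingCut G M
  finite_sol := graphSolutions_finite _
  κ := ndParameter

/-- The enumeration of all maximal matching cuts, parameterized by the neighborhood diversity. -/
noncomputable def enumMaximalMC : ParamEnumProblem where
  Sol := graphSolutions fun _ G M => IsMaximalMatchingCut G M
  finite_sol := graphSolutions_finite _
  κ := ndParameter

/-- For every graph `G`, the program `A` outputs the encoding of a graph with at most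
`b (nd G)` vertices. -/
def KernelVerticesLE (A : Prog) (b : ℕ → ℕ) : Prop :=
  ∀ (n : ℕ) (G : SimpleGraph (Fin n)), ∃ (m : ℕ) (H : SimpleGraph (Fin m)) (tr : Trace),
    RunsWith A [encodeGraph G] tr ∧ outputs tr = [encodeGraph H] ∧
      m ≤ b (neighborhoodDiversity G)

end EnumKernel

/-! Call two vertices twins if they have the same neighbors besides themselves. This is an
equivalence relation, and each part of a neighborhood decomposition consists of mutual twins. The
kernel keeps the three smallest vertices of every twin class (those of `rank` less than three) and
hence has at most `3 * nd` vertices.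

The central fact is `CutBy.three_twins`: if a vertex with two further twins is incident with a
matching cut, then it is pendant and none of its twins is incident with the cut. So at most one
vertex of a large class meets the cut, and which one it is does not matter. Every vertex has a
representative `rep`: itself if its rank is at most two, and otherwise its twin of rank two. A
choice `c` picks for every kernel vertex some vertex that it represents. Its range induces a copy of
the kernel (`IsChoice.comap_eq`), and every vertex outside the range has three twins inside
(`IsChoice.isTwinKernel`). Hence `M` is a matching cut of the kernel iff its image under `c` is one
of `G`, and the same holds for minimal and maximal cuts. Conversely every matching cut of `G` is the
image of a kernel cut under some choice (`IsMatchingCut.exists_choice`). Applying `rep` to a lift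
recovers the cut of the kernel, so lifts of different cuts differ. The lifts of the solutions of the
kernel therefore partition the solutions of `G`.

To list the lifts of `M` without repetition, only kernel vertices that are incident with `M` get a
nontrivial fiber. The lifts then correspond to digit vectors bounded by the fiber sizes, and a mixed
radix counter runs through these with polynomial delay. If `M` is minimal, at most one fiber is
nontrivial (`IsMinimalMatchingCut.incident_unique`): a pendant edge alone is already a matching cut.
So there are at most `n + 1` lifts, and the total time is polynomial.

The programs are written with counting loops, whose running time and effect are derived once and for
all. Memory: register 3 holds the number `n` of vertices and array 3 the starts `i * n` of the rows.
Arrays 4 and 5 hold twins and ranks, array 6 the cut inside `G`, arrays 7, 8, 9 the active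
representatives, the indices in fibers and the fiber sizes, array 10 the digits, and array 14 the
positions in the kernel. -/

namespace EnumKernel

/-! ### Matching cuts and twins -/

section Twins

variable {V W : Type*}

/-- `M` is a matching and the set of edges of `G` between `A` and its complement. -/
structure CutBy (G : SimpleGraph V) (M : Set (Sym2 V)) (A : Set V) : Prop where
  mem_iff : ∀ u v, s(u, v) ∈ M ↔ G.Adj u v ∧ (u ∈ A ↔ v ∉ A)
  matching : ∀ u v w, s(u, v) ∈ M → s(u, w) ∈ M → v = w

/-- The partition is replaced by one side `A` and its complement, and membership of edges becomes a
propositional condition on their ends. -/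
theorem isMatchingCut_iff {G : SimpleGraph V} {M : Set (Sym2 V)} :
    IsMatchingCut G M ↔ ∃ A : Set V, A.Nonempty ∧ Aᶜ.Nonempty ∧ CutBy G M A := by
  constructor
  · rintro ⟨⟨A, B, hA, hB, hAB, hU, rfl⟩, hM⟩
    have hBA : B = Aᶜ := by
      refine (eq_compl_iff_isCompl.mpr ⟨hAB.symm, ?_⟩)
      rw [codisjoint_iff, sup_comm]; exact hU
    subst hBA
    refine ⟨A, hA, hB, ⟨fun u v => ?_, fun u v w huv huw => ?_⟩⟩
    · constructor
      · rintro ⟨a, ha, b, hb, hab, he⟩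
        rw [Sym2.eq_iff] at he
        rcases he with ⟨rfl, rfl⟩ | ⟨rfl, rfl⟩
        · exact ⟨hab, by simpa [ha] using hb⟩
        · exact ⟨hab.symm, by simpa [ha] using hb⟩
      · rintro ⟨hadj, hc⟩
        by_cases hu : u ∈ A
        · exact ⟨u, hu, v, hc.mp hu, hadj, rfl⟩
        · exact ⟨v, by_contra fun hv => hu (hc.mpr hv), u, hu, hadj.symm, Sym2.eq_swap⟩
    · have := hM _ huv _ huw u (by simp) (by simp)
      exact Sym2.congr_right.mp this
  · rintro ⟨A, hA, hB, h⟩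
    refine ⟨⟨A, Aᶜ, hA, hB, disjoint_compl_right, Set.union_compl_self A, ?_⟩, ?_⟩
    · ext e
      induction e with
      | _ u v =>
        rw [h.mem_iff]
        constructor
        · rintro ⟨hadj, hc⟩
          by_cases hu : u ∈ A
          · exact ⟨u, hu, v, hc.mp hu, hadj, rfl⟩
          · exact ⟨v, by_contra fun hv => hu (hc.mpr hv), u, hu, hadj.symm, Sym2.eq_swap⟩
        · rintro ⟨a, ha, b, hb, hab, he⟩
          rw [Sym2.eq_iff] at he
          rcases he with ⟨rfl, rfl⟩ | ⟨rfl, rfl⟩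
          · exact ⟨hab, by simpa [ha] using hb⟩
          · exact ⟨hab.symm, by simpa [ha] using hb⟩
    · intro e he f hf v hve hvf
      obtain ⟨a, rfl⟩ := Sym2.mem_iff_exists.mp hve
      obtain ⟨b, rfl⟩ := Sym2.mem_iff_exists.mp hvf
      rw [h.matching v a b he hf]

/-- Some edge of `M` is incident with `v`. -/
def Incident (M : Set (Sym2 V)) (v : V) : Prop := ∃ w, s(v, w) ∈ M

/-- Two vertices are twins if they have the same neighbors besides themselves. -/
def Twin (G : SimpleGraph V) (u v : V) : Prop :=
  ∀ w, w ≠ u → w ≠ v → (G.Adj u w ↔ G.Adj v w)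

theorem Twin.refl (G : SimpleGraph V) (u : V) : Twin G u u := fun _ _ _ => Iff.rfl

theorem Twin.symm {G : SimpleGraph V} {u v : V} (h : Twin G u v) : Twin G v u :=
  fun w h1 h2 => (h w h2 h1).symm

theorem Twin.trans {G : SimpleGraph V} {u v w : V} (h : Twin G u v) (h' : Twin G v w) :
    Twin G u w := by
  intro x hu hw
  -- The middle vertex is exempt in both hypotheses; the adjacency of `u` and `v` is carried to that
  -- of `w` and `v` through the pair `u`, `w`.
  by_cases hx : x = v
  · subst hx
    by_cases huw : u = w
    · rw [huw]
    · rw [G.adj_comm u, h' u hu.symm huw, G.adj_comm w u, h w (Ne.symm huw) hw.symm, G.adj_comm]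
  · exact (h x hu hx).trans (h' x hx hw)

theorem Twin.comap {G : SimpleGraph V} {φ : W → V} (hφ : Function.Injective φ) {a b : W}
    (h : Twin G (φ a) (φ b)) : Twin (G.comap φ) a b :=
  fun w h1 h2 => h (φ w) (hφ.ne h1) (hφ.ne h2)

/-- The third vertex of a triangle is separated from one end of the cut edge, and that end would
have two cut edges. -/
theorem CutBy.triangle {G : SimpleGraph V} {M : Set (Sym2 V)} {A : Set V} (h : CutBy G M A)
    {u v w : V} (huv : s(u, v) ∈ M) (huw : G.Adj u w) (hvw : G.Adj v w) : False := by
  have h1 := (h.mem_iff u v).mp huv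
  by_cases hc : u ∈ A ↔ w ∉ A
  · exact hvw.ne (h.matching u v w huv ((h.mem_iff u w).mpr ⟨huw, hc⟩))
  · have h2 : s(v, w) ∈ M := (h.mem_iff v w).mpr ⟨hvw, by tauto⟩
    exact huw.ne (h.matching v u w (Sym2.eq_swap ▸ huv) h2)

/-- A vertex with two further twins that is incident with a matching cut is pendant, and its
twins are not incident with the matching cut. -/
theorem CutBy.three_twins {G : SimpleGraph V} {M : Set (Sym2 V)} {A : Set V} (h : CutBy G M A)
    {t t₁ t₂ w : V} (h01 : t ≠ t₁) (h02 : t ≠ t₂) (h12 : t₁ ≠ t₂) (ht1 : Twin G t t₁)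
    (ht2 : Twin G t t₂) (hM : s(t, w) ∈ M) :
    (∀ x, G.Adj t x → x = w) ∧ ¬ Incident M t₁ := by
  have hw := (h.mem_iff t w).mp hM
  -- If the cut edge joined `t` to a twin, another twin would complete a triangle.
  have key : ∀ a b, t ≠ a → t ≠ b → a ≠ b → Twin G t a → Twin G t b → w ≠ a := by
    rintro a b hta htb hab ha hb rfl
    have h1 : G.Adj b w := (hb w hta.symm hab).mp hw.1
    have h2 : G.Adj t b := ((ha b htb.symm hab.symm).mpr h1.symm)
    exact h.triangle hM h2 h1.symm
  have hw1 := key t₁ t₂ h01 h02 h12 ht1 ht2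
  have hw2 := key t₂ t₁ h02 h01 h12.symm ht2 ht1
  have a1 : G.Adj t₁ w := (ht1 w hw.1.ne' hw1).mp hw.1
  have a2 : G.Adj t₂ w := (ht2 w hw.1.ne' hw2).mp hw.1
  have hn : ∀ a, t ≠ a → G.Adj a w → ¬ G.Adj t a ∧ ¬ (a ∈ A ↔ w ∉ A) := by
    intro a hta haw
    refine ⟨fun hadj => h.triangle hM hadj haw.symm, fun hc => ?_⟩
    have h2 : s(a, w) ∈ M := (h.mem_iff a w).mpr ⟨haw, hc⟩
    exact hta (h.matching w t a (Sym2.eq_swap ▸ hM) (Sym2.eq_swap ▸ h2))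
  obtain ⟨n1, c1⟩ := hn t₁ h01 a1
  obtain ⟨n2, c2⟩ := hn t₂ h02 a2
  -- Another neighbor `x` of `t` is on the side of `t`, while `t₁` and `t₂` are on the side of `w`.
  -- Both are adjacent to `x`, so `x` would have two cut edges.
  have deg : ∀ x, G.Adj t x → x = w := by
    intro x hx
    by_contra hxw
    have x1 : x ≠ t₁ := fun e => n1 (e ▸ hx)
    have x2 : x ≠ t₂ := fun e => n2 (e ▸ hx)
    have b1 := (ht1 x hx.ne' x1).mp hx
    have b2 := (ht2 x hx.ne' x2).mp hx
    have hc : ¬ (t ∈ A ↔ x ∉ A) := fun hc =>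
      hxw (h.matching t w x hM ((h.mem_iff t x).mpr ⟨hx, hc⟩)).symm
    refine h12 (h.matching x t₁ t₂ ((h.mem_iff _ _).mpr ⟨b1.symm, ?_⟩)
      ((h.mem_iff _ _).mpr ⟨b2.symm, ?_⟩)) <;> tauto
  refine ⟨deg, ?_⟩
  rintro ⟨y, hy⟩
  have hy' := (h.mem_iff _ _).mp hy
  have hyt : y ≠ t := fun e => n1 (e ▸ hy'.1.symm)
  have hyw := deg y ((ht1 y hyt hy'.1.ne').mpr hy'.1)
  subst hyw
  exact c1 hy'.2

/-! ### Matching cuts of a graph and of a twin kernel -/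

/-- An injective map into the vertex set such that every vertex outside its range has three twins
in the range. -/
structure IsTwinKernel (G : SimpleGraph V) (φ : W → V) : Prop where
  injective : Function.Injective φ
  twins : ∀ v, v ∉ Set.range φ → ∃ a b c : W, a ≠ b ∧ a ≠ c ∧ b ≠ c ∧
    Twin G v (φ a) ∧ Twin G v (φ b) ∧ Twin G v (φ c)

theorem mem_image_map {φ : W → V} (hφ : Function.Injective φ) {M : Set (Sym2 W)} {a b : W} :
    s(φ a, φ b) ∈ Sym2.map φ '' M ↔ s(a, b) ∈ M := by
  rw [← Sym2.map_mk, (Sym2.map.injective hφ).mem_set_image]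

theorem image_ssubset_iff {α β : Type*} {f : α → β} (hf : Function.Injective f) {s t : Set α} :
    f '' s ⊂ f '' t ↔ s ⊂ t :=
  hf.injOn.image_ssubset_image_iff (Set.subset_univ _) (Set.subset_univ _)

theorem mem_range_of_mem_image_map {φ : W → V} {M : Set (Sym2 W)} {u v : V}
    (h : s(u, v) ∈ Sym2.map φ '' M) : u ∈ Set.range φ ∧ v ∈ Set.range φ := by
  obtain ⟨e, -, he⟩ := h
  induction e with
  | _ a b =>
    rw [Sym2.map_mk, Sym2.eq_iff] at he
    rcases he with ⟨rfl, rfl⟩ | ⟨rfl, rfl⟩ <;> simp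

/-- A vertex outside the range joins the side of a twin in the range that is not incident with `M`.
Its edges then behave like uncut edges of that twin, so no edge is added to the cut. -/
theorem IsTwinKernel.isMatchingCut_image {G : SimpleGraph V} {φ : W → V} (hφ : IsTwinKernel G φ)
    {M : Set (Sym2 W)} (hM : IsMatchingCut (G.comap φ) M) :
    IsMatchingCut G (Sym2.map φ '' M) := by
  obtain ⟨A, ⟨a₀, ha₀⟩, ⟨b₀, hb₀⟩, h⟩ := isMatchingCut_iff.mp hM
  have ex : ∀ v, ∃ a : W, (∀ b, v = φ b → b = a) ∧
      (v ∉ Set.range φ → Twin G v (φ a) ∧ ¬ Incident M a) := by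
    intro v
    by_cases hv : v ∈ Set.range φ
    · obtain ⟨b, rfl⟩ := hv
      exact ⟨b, fun c hc => hφ.injective hc.symm, fun hv => absurd (Set.mem_range_self b) hv⟩
    -- Among three mutual twins at most one is incident with `M`, so `a` or else `b` will do.
    · obtain ⟨a, b, c, hab, hac, hbc, ta, tb, tc⟩ := hφ.twins v hv
      have t1 : Twin (G.comap φ) a b := (ta.symm.trans tb).comap hφ.injective
      have t2 : Twin (G.comap φ) a c := (ta.symm.trans tc).comap hφ.injective
      by_cases hi : Incident M a
      · obtain ⟨w, hw⟩ := hi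
        exact ⟨b, fun d hd => absurd ⟨d, hd.symm⟩ hv,
          fun _ => ⟨tb, (h.three_twins hab hac hbc t1 t2 hw).2⟩⟩
      · exact ⟨a, fun d hd => absurd ⟨d, hd.symm⟩ hv, fun _ => ⟨ta, hi⟩⟩
  choose τ hτ hτ' using ex
  have hτφ : ∀ a, τ (φ a) = a := fun a => (hτ _ a rfl).symm
  -- Move the edge to `τ u`, `τ v` one end at a time. It is not in `M`, since `τ u` is not incident
  -- with `M`.
  have aux : ∀ u v, u ∉ Set.range φ → G.Adj u v → (τ u ∈ A ↔ τ v ∈ A) := by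
    intro u v hu huv
    by_cases hne : τ u = τ v
    · rw [hne]
    have hv' : G.Adj u (φ (τ v)) := by
      by_cases hv : v ∈ Set.range φ
      · obtain ⟨b, rfl⟩ := hv
        rwa [hτφ]
      · exact (((hτ' v hv).1 u huv.ne fun e => hu ⟨_, e.symm⟩).mp huv.symm).symm
    have h2 := ((hτ' u hu).1 (φ (τ v)) (fun e => hu ⟨_, e⟩)
      (fun e => hne (hφ.injective e).symm)).mp hv'
    have h3 : s(τ u, τ v) ∉ M := fun hm => (hτ' u hu).2 ⟨_, hm⟩
    rw [h.mem_iff, SimpleGraph.comap_adj] at h3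
    tauto
  refine isMatchingCut_iff.mpr ⟨{v | τ v ∈ A}, ⟨φ a₀, by simpa [hτφ] using ha₀⟩,
    ⟨φ b₀, by simpa [hτφ] using hb₀⟩, ⟨fun u v => ?_, fun u v w huv huw => ?_⟩⟩
  · simp only [Set.mem_ofPred_eq]
    by_cases hu : u ∈ Set.range φ
    · by_cases hv : v ∈ Set.range φ
      · obtain ⟨a, rfl⟩ := hu
        obtain ⟨b, rfl⟩ := hv
        rw [mem_image_map hφ.injective, h.mem_iff, hτφ, hτφ, SimpleGraph.comap_adj]
      · refine ⟨fun hm => absurd (mem_range_of_mem_image_map hm).2 hv, fun hm => ?_⟩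
        have := aux v u hv hm.1.symm
        tauto
    · refine ⟨fun hm => absurd (mem_range_of_mem_image_map hm).1 hu, fun hm => ?_⟩
      have := aux u v hu hm.1
      tauto
  · obtain ⟨a, rfl⟩ := (mem_range_of_mem_image_map huv).1
    obtain ⟨b, rfl⟩ := (mem_range_of_mem_image_map huv).2
    obtain ⟨c, rfl⟩ := (mem_range_of_mem_image_map huw).2
    rw [mem_image_map hφ.injective] at huv huw
    rw [h.matching a b c huv huw]

/-- The sides are restricted to the range. This fails only if the range lies on one side; then `M`
is empty, and a vertex on the other side has no neighbor in the range. Its twins in the range are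
isolated in the induced graph, so splitting one of them off realizes the empty cut. -/
theorem IsTwinKernel.isMatchingCut_of_image {G : SimpleGraph V} {φ : W → V}
    (hφ : IsTwinKernel G φ) {M : Set (Sym2 W)} (hM : IsMatchingCut G (Sym2.map φ '' M)) :
    IsMatchingCut (G.comap φ) M := by
  obtain ⟨A, hA, hB, h⟩ := isMatchingCut_iff.mp hM
  have hcut : CutBy (G.comap φ) M (φ ⁻¹' A) := by
    refine ⟨fun u v => ?_, fun u v w huv huw => ?_⟩
    · rw [← mem_image_map hφ.injective, h.mem_iff]; rfl
    · rw [← mem_image_map hφ.injective] at huv huw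
      exact hφ.injective (h.matching _ _ _ huv huw)
  -- a vertex that is separated from the whole range is isolated
  have main : ∀ v, v ∉ Set.range φ → (∀ a, ¬ (v ∈ A ↔ φ a ∈ A)) →
      IsMatchingCut (G.comap φ) M := by
    intro v hv hsep
    obtain ⟨a, b, c, hab, hac, hbc, ta, tb, tc⟩ := hφ.twins v hv
    have hnr : ∀ d, ¬ G.Adj v (φ d) := by
      intro d hd
      have : s(v, φ d) ∈ Sym2.map φ '' M := (h.mem_iff _ _).mpr ⟨hd, by have := hsep d; tauto⟩
      exact hv (mem_range_of_mem_image_map this).1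
    have hiso : ∀ d, ¬ G.Adj (φ a) (φ d) := by
      intro d hd
      refine hnr d ((ta (φ d) (fun e => hv ⟨_, e⟩) hd.ne').mpr hd)
    have hempty : ∀ u w, s(u, w) ∉ M := by
      intro u w hm
      have h1 := (hcut.mem_iff u w).mp hm
      have h2 := hsep u
      have h3 := hsep w
      simp only [Set.mem_preimage] at h1
      tauto
    refine isMatchingCut_iff.mpr ⟨{a}, ⟨a, rfl⟩, ⟨b, fun e => hab (by simpa using e.symm)⟩,
      ⟨fun u w => ⟨fun hm => absurd hm (hempty u w), ?_⟩, fun u w _ hm => absurd hm (hempty u w)⟩⟩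
    rintro ⟨hadj, hc⟩
    rw [SimpleGraph.comap_adj] at hadj
    simp only [Set.mem_singleton_iff] at hc
    by_cases hu : u = a
    · subst hu; exact absurd hadj (hiso w)
    · have hw : w = a := by tauto
      subst hw; exact absurd hadj.symm (hiso u)
  by_cases h1 : (φ ⁻¹' A).Nonempty
  · by_cases h2 : (φ ⁻¹' A)ᶜ.Nonempty
    · exact isMatchingCut_iff.mpr ⟨_, h1, h2, hcut⟩
    · obtain ⟨v, hv⟩ := hB
      have hall : ∀ a, φ a ∈ A := fun a => by
        by_contra hc; exact h2 ⟨a, hc⟩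
      exact main v (by rintro ⟨a, rfl⟩; exact hv (hall a)) fun a => by
        have := hall a; simp only [Set.mem_compl_iff] at hv; tauto
  · obtain ⟨v, hv⟩ := hA
    have hall : ∀ a, φ a ∉ A := fun a hc => h1 ⟨a, hc⟩
    exact main v (by rintro ⟨a, rfl⟩; exact hall a hv) fun a => by
      have := hall a; tauto

theorem IsTwinKernel.isMatchingCut_image_iff {G : SimpleGraph V} {φ : W → V}
    (hφ : IsTwinKernel G φ) {M : Set (Sym2 W)} :
    IsMatchingCut G (Sym2.map φ '' M) ↔ IsMatchingCut (G.comap φ) M :=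
  ⟨hφ.isMatchingCut_of_image, hφ.isMatchingCut_image⟩

/-- A smaller cut of `G` lies inside an image and is therefore an image itself. A larger cut need
not be one, so maximality requires varying the map and is treated later. -/
theorem IsTwinKernel.isMinimalMatchingCut_image_iff {G : SimpleGraph V} {φ : W → V}
    (hφ : IsTwinKernel G φ) {M : Set (Sym2 W)} :
    IsMinimalMatchingCut G (Sym2.map φ '' M) ↔ IsMinimalMatchingCut (G.comap φ) M := by
  have hinj := Sym2.map.injective hφ.injective
  unfold IsMinimalMatchingCut
  rw [hφ.isMatchingCut_image_iff]
  refine and_congr_right fun _ => ⟨fun h N hN hlt => ?_, fun h N hN hlt => ?_⟩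
  · exact h _ (hφ.isMatchingCut_image hN) ((image_ssubset_iff hinj).mpr hlt)
  · obtain ⟨N', -, rfl⟩ := Set.subset_image_iff.mp hlt.subset
    exact h N' (hφ.isMatchingCut_of_image hN) ((image_ssubset_iff hinj).mp hlt)

/-- In a minimal matching cut at most one vertex with two further twins is incident with the
cut. -/
theorem IsMinimalMatchingCut.incident_unique {G : SimpleGraph V} {M : Set (Sym2 V)}
    (hM : IsMinimalMatchingCut G M) {v v' : V}
    (hv : ∃ a b, v ≠ a ∧ v ≠ b ∧ a ≠ b ∧ Twin G v a ∧ Twin G v b)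
    (hv' : ∃ a b, v' ≠ a ∧ v' ≠ b ∧ a ≠ b ∧ Twin G v' a ∧ Twin G v' b)
    (hi : Incident M v) (hi' : Incident M v') : v = v' := by
  obtain ⟨A, hA, hB, h⟩ := isMatchingCut_iff.mp hM.1
  obtain ⟨w, hw⟩ := hi
  obtain ⟨w', hw'⟩ := hi'
  obtain ⟨a, b, hva, hvb, hab, ta, tb⟩ := hv
  obtain ⟨a', b', hva', hvb', hab', ta', tb'⟩ := hv'
  have d := (h.three_twins hva hvb hab ta tb hw).1
  have d' := (h.three_twins hva' hvb' hab' ta' tb' hw').1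
  have hadj := ((h.mem_iff _ _).mp hw).1
  -- The vertex `v` is pendant, so separating it from the rest cuts exactly one edge. Minimality
  -- then forces `M` to be this edge.
  have hcut : IsMatchingCut G {s(v, w)} := by
    refine isMatchingCut_iff.mpr ⟨{v}, ⟨v, rfl⟩, ⟨w, fun e => hadj.ne (by simpa using e.symm)⟩,
      ⟨fun x y => ?_, fun x y z hxy hxz => ?_⟩⟩
    · rw [Set.mem_singleton_iff, Sym2.eq_iff]
      constructor
      · rintro (⟨rfl, rfl⟩ | ⟨rfl, rfl⟩)
        · exact ⟨hadj, by simpa using hadj.ne'⟩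
        · exact ⟨hadj.symm, by simpa using hadj.ne'⟩
      · rintro ⟨hxy, hc⟩
        simp only [Set.mem_singleton_iff] at hc
        by_cases hx : x = v
        · subst hx; exact Or.inl ⟨rfl, d y hxy⟩
        · have hy : y = v := by tauto
          subst hy; exact Or.inr ⟨d x hxy.symm, rfl⟩
    · rw [Set.mem_singleton_iff] at hxy hxz
      exact Sym2.congr_right.mp (hxy.trans hxz.symm)
  have hsub : ({s(v, w)} : Set (Sym2 V)) ⊆ M := by simpa using hw
  have hMeq : M = {s(v, w)} := by
    by_contra hne
    exact hM.2 _ hcut (hsub.ssubset_of_ne (Ne.symm hne))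
  rw [hMeq, Set.mem_singleton_iff, Sym2.eq_iff] at hw'
  rcases hw' with ⟨h1, -⟩ | ⟨rfl, rfl⟩
  · exact h1.symm
  -- The second vertex could only be the neighbor of `v`. A twin of that neighbor other than `v`
  -- would be a second neighbor of `v`, so `v` is its only twin, while two are given.
  · exfalso
    have : ∀ t, v' ≠ t → Twin G v' t → t = w' := by
      intro t hne ht
      by_contra hcon
      have := d t ((ht w' hadj.ne (Ne.symm hcon)).mp hadj.symm).symm
      exact hne this.symm
    exact hab' ((this a' hva' ta').trans (this b' hvb' tb').symm)

end Twins

/-! ### The kernel of a graph -/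

section Rank

open Classical in
/-- The number of smaller twins. -/
noncomputable def rank {n : ℕ} (G : SimpleGraph (Fin n)) (v : Fin n) : ℕ :=
  (Finset.univ.filter fun u => u < v ∧ Twin G v u).card

variable {n : ℕ} {G : SimpleGraph (Fin n)}

theorem rank_lt_rank {u v : Fin n} (huv : u < v) (h : Twin G v u) : rank G u < rank G v := by
  classical
  refine Finset.card_lt_card ?_
  rw [Finset.ssubset_iff_of_subset]
  · exact ⟨u, by simp [huv, h], by simp⟩
  · intro w
    simp only [Finset.mem_filter, Finset.mem_univ, true_and]
    exact fun hw => ⟨hw.1.trans huv, h.trans hw.2⟩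

theorem Twin.eq_of_rank_eq {u v : Fin n} (h : Twin G u v) (hr : rank G u = rank G v) : u = v := by
  rcases lt_trichotomy u v with hlt | rfl | hlt
  · exact absurd hr (rank_lt_rank hlt h.symm).ne
  · rfl
  · exact absurd hr (rank_lt_rank hlt h).ne'

/-- The `rank G v` smaller twins of `v` have distinct ranks below `rank G v`, so by counting every
value below occurs. -/
theorem exists_twin_of_lt_rank {v : Fin n} {r : ℕ} (hr : r < rank G v) :
    ∃ u, Twin G v u ∧ rank G u = r := by
  classical
  set S := Finset.univ.filter fun u => u < v ∧ Twin G v u with hS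
  have hsub : S.image (rank G) ⊆ Finset.range (rank G v) := by
    intro k hk
    obtain ⟨u, hu, rfl⟩ := Finset.mem_image.mp hk
    simp only [hS, Finset.mem_filter, Finset.mem_univ, true_and] at hu
    exact Finset.mem_range.mpr (rank_lt_rank hu.1 hu.2)
  have hcard : (S.image (rank G)).card = rank G v := by
    rw [Finset.card_image_of_injOn]
    · rfl
    · intro a ha b hb hab
      simp only [hS, Finset.coe_filter, Finset.mem_univ, true_and, Set.mem_ofPred_eq] at ha hb
      exact (ha.2.symm.trans hb.2).eq_of_rank_eq hab
  have := Finset.eq_of_subset_of_card_le hsub (by simp [hcard])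
  have hr' : r ∈ S.image (rank G) := this ▸ Finset.mem_range.mpr hr
  obtain ⟨u, hu, rfl⟩ := Finset.mem_image.mp hr'
  simp only [hS, Finset.mem_filter, Finset.mem_univ, true_and] at hu
  exact ⟨u, hu.2, rfl⟩

open Classical in
/-- The vertex of rank at most two that represents a vertex. -/
noncomputable def rep (G : SimpleGraph (Fin n)) (v : Fin n) : Fin n :=
  if h : 2 < rank G v then (exists_twin_of_lt_rank h).choose else v

theorem rep_of_rank_lt {v : Fin n} (h : rank G v < 3) : rep G v = v := dif_neg (by omega)

theorem twin_rep (v : Fin n) : Twin G v (rep G v) := by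
  unfold rep
  split_ifs with h
  · exact (exists_twin_of_lt_rank h).choose_spec.1
  · exact Twin.refl G v

theorem rank_rep (v : Fin n) : rank G (rep G v) = min (rank G v) 2 := by
  unfold rep
  split_ifs with h
  · rw [(exists_twin_of_lt_rank h).choose_spec.2]; omega
  · omega

theorem rank_rep_lt (v : Fin n) : rank G (rep G v) < 3 := by rw [rank_rep]; omega

/-- Identifies the representative, defined by an arbitrary choice, with the vertex that the program
finds by search. -/
theorem rep_eq {u v : Fin n} (h : Twin G v u) (hu : rank G u = 2) (hv : 2 < rank G v) :
    rep G v = u :=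
  ((twin_rep v).symm.trans h).eq_of_rank_eq (by rw [rank_rep]; omega)

open Classical in
/-- The vertices of the kernel. -/
noncomputable def keptList (G : SimpleGraph (Fin n)) : List (Fin n) :=
  (List.finRange n).filter fun v => rank G v < 3

theorem mem_keptList {v : Fin n} : v ∈ keptList G ↔ rank G v < 3 := by
  simp [keptList]

theorem nodup_keptList : (keptList G).Nodup := (List.nodup_finRange n).filter _

/-- The embedding of the vertices of the kernel. -/
noncomputable def keep (G : SimpleGraph (Fin n)) (a : Fin (keptList G).length) : Fin n :=
  (keptList G).get a

theorem keep_injective : Function.Injective (keep G) := nodup_keptList.injective_get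

theorem exists_keep {v : Fin n} (h : rank G v < 3) : ∃ a, keep G a = v :=
  List.mem_iff_get.mp (mem_keptList.mpr h)

theorem rank_keep_lt (a : Fin (keptList G).length) : rank G (keep G a) < 3 :=
  mem_keptList.mp (List.get_mem _ _)

/-- The kernel. -/
noncomputable def kernel (G : SimpleGraph (Fin n)) : SimpleGraph (Fin (keptList G).length) :=
  G.comap (keep G)

/-! ### Choices, and the lifts of a cut along them -/

/-- A choice of a vertex with the given representative for each vertex of the kernel. -/
def IsChoice (G : SimpleGraph (Fin n)) (c : Fin (keptList G).length → Fin n) : Prop :=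
  ∀ a, rep G (c a) = keep G a

theorem isChoice_keep : IsChoice G (keep G) := fun a => rep_of_rank_lt (rank_keep_lt a)

variable {c : Fin (keptList G).length → Fin n}

theorem IsChoice.injective (hc : IsChoice G c) : Function.Injective c := fun a b h =>
  keep_injective (by rw [← hc a, ← hc b, h])

theorem IsChoice.twin (hc : IsChoice G c) (a) : Twin G (keep G a) (c a) := by
  rw [← hc a]; exact (twin_rep _).symm

/-- The ends of a pair are replaced by twins one at a time. The case distinctions handle
coincidences in which the twin relation says nothing. -/
theorem IsChoice.comap_eq (hc : IsChoice G c) : G.comap c = kernel G := by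
  ext a b
  simp only [kernel, SimpleGraph.comap_adj]
  by_cases hab : a = b
  · subst hab; simp
  have hk : keep G a ≠ keep G b := keep_injective.ne hab
  have hcc : c a ≠ c b := hc.injective.ne hab
  by_cases h1 : c a = keep G b
  · rw [h1]
    by_cases h2 : c b = keep G a
    · rw [h2, G.adj_comm]
    · have t : Twin G (c b) (keep G a) :=
        (hc.twin b).symm.trans (h1 ▸ (hc.twin a).symm)
      rw [G.adj_comm, t (keep G b) (h1 ▸ hcc) hk.symm]
  · rw [G.adj_comm (c a), ← hc.twin b (c a) h1 hcc, G.adj_comm,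
      ← hc.twin a (keep G b) hk.symm (Ne.symm h1)]

/-- A vertex outside the range has rank above two, or else it is a kept vertex replaced by one of
rank above two. In both cases its class contains vertices of ranks 0, 1 and 2, and the chosen
vertices for these are three twins in the range. -/
theorem IsChoice.isTwinKernel (hc : IsChoice G c) : IsTwinKernel G c := by
  refine ⟨hc.injective, fun v hv => ?_⟩
  have main : ∀ w, 2 < rank G w → Twin G v w → ∃ a b d, a ≠ b ∧ a ≠ d ∧ b ≠ d ∧
      Twin G v (c a) ∧ Twin G v (c b) ∧ Twin G v (c d) := by
    intro w hw t
    have ex : ∀ r < 3, ∃ a, rank G (keep G a) = r ∧ Twin G v (c a) := by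
      intro r hr
      obtain ⟨u, hu, hur⟩ := exists_twin_of_lt_rank (show r < rank G w by omega)
      obtain ⟨a, rfl⟩ := exists_keep (show rank G u < 3 by omega)
      exact ⟨a, hur, t.trans (hu.trans (hc.twin a))⟩
    obtain ⟨a, ha, ta⟩ := ex 0 (by omega)
    obtain ⟨b, hb, tb⟩ := ex 1 (by omega)
    obtain ⟨d, hd, td⟩ := ex 2 (by omega)
    refine ⟨a, b, d, ?_, ?_, ?_, ta, tb, td⟩ <;> rintro rfl <;> omega
  by_cases hr : 2 < rank G v
  · exact main v hr (Twin.refl G v)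
  · obtain ⟨a, rfl⟩ := exists_keep (show rank G v < 3 by omega)
    refine main (c a) ?_ (hc.twin a)
    by_contra hlt
    have := hc a
    rw [rep_of_rank_lt (by omega)] at this
    exact hv ⟨a, this⟩

/-- Vertices with the same representative that are incident with the same matching cut are
equal. -/
theorem eq_of_rep_eq {M : Set (Sym2 (Fin n))} (hM : IsMatchingCut G M) {u v : Fin n}
    (hu : Incident M u) (hv : Incident M v) (h : rep G u = rep G v) : u = v := by
  by_contra hne
  -- Vertices of rank at most two represent themselves, so one of the two has larger rank. The other
  -- then has rank at least two, and the twin of rank 0 is the third vertex needed below.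
  wlog hr : 2 < rank G u generalizing u v
  · by_cases hr' : 2 < rank G v
    · exact this hv hu h.symm (Ne.symm hne) hr'
    · rw [rep_of_rank_lt (by omega), rep_of_rank_lt (by omega)] at h
      exact hne h
  obtain ⟨A, -, -, hA⟩ := isMatchingCut_iff.mp hM
  have h1 := rank_rep (G := G) u
  have h2 := rank_rep (G := G) v
  rw [h] at h1
  obtain ⟨t, ht, htr⟩ := exists_twin_of_lt_rank (show 0 < rank G u by omega)
  obtain ⟨w, hw⟩ := hu
  refine (hA.three_twins (t₁ := v) (t₂ := t) hne ?_ ?_ ?_ ht hw).2 hv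
  · rintro rfl; omega
  · rintro rfl; omega
  · exact (twin_rep u).trans (h ▸ (twin_rep v).symm)

/-- Among the vertices with a given representative at most one is incident with `M`; it is chosen if
it exists. Then all ends of edges of `M` are in the range of the choice. -/
theorem IsMatchingCut.exists_choice {M : Set (Sym2 (Fin n))} (hM : IsMatchingCut G M) :
    ∃ c, IsChoice G c ∧ ∃ M', M = Sym2.map c '' M' := by
  classical
  have ex : ∀ a, ∃ u, rep G u = keep G a ∧ ∀ v, rep G v = keep G a → Incident M v → v = u := by
    intro a
    by_cases h : ∃ u, rep G u = keep G a ∧ Incident M u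
    · obtain ⟨u, hu, hi⟩ := h
      exact ⟨u, hu, fun v hv hiv => eq_of_rep_eq hM hiv hi (hv.trans hu.symm)⟩
    · exact ⟨keep G a, isChoice_keep a, fun v hv hiv => absurd ⟨v, hv, hiv⟩ h⟩
  choose c hc hc' using ex
  refine ⟨c, hc, Sym2.map c ⁻¹' M, (Set.image_preimage_eq_of_subset ?_).symm⟩
  have hr : ∀ v, Incident M v → ∃ a, v = c a := by
    intro v hv
    obtain ⟨a, ha⟩ := exists_keep (rank_rep_lt (G := G) v)
    exact ⟨a, hc' a v ha.symm hv⟩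
  intro e he
  induction e with
  | _ u v =>
    obtain ⟨a, rfl⟩ := hr u ⟨v, he⟩
    obtain ⟨b, rfl⟩ := hr v ⟨c a, Sym2.eq_swap ▸ he⟩
    exact ⟨s(a, b), rfl⟩

/-- The representatives undo every choice. This makes lifts of different cuts disjoint and lets
lifts along different choices be compared. -/
theorem IsChoice.image_rep (hc : IsChoice G c) (M : Set (Sym2 (Fin (keptList G).length))) :
    Sym2.map (rep G) '' (Sym2.map c '' M) = Sym2.map (keep G) '' M := by
  rw [← Set.image_comp, ← Sym2.map_comp, show rep G ∘ c = keep G from funext hc]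

theorem IsChoice.isMatchingCut_image_iff (hc : IsChoice G c)
    {M : Set (Sym2 (Fin (keptList G).length))} :
    IsMatchingCut G (Sym2.map c '' M) ↔ IsMatchingCut (kernel G) M := by
  rw [hc.isTwinKernel.isMatchingCut_image_iff, hc.comap_eq]

theorem IsChoice.isMinimalMatchingCut_image_iff (hc : IsChoice G c)
    {M : Set (Sym2 (Fin (keptList G).length))} :
    IsMinimalMatchingCut G (Sym2.map c '' M) ↔ IsMinimalMatchingCut (kernel G) M := by
  rw [hc.isTwinKernel.isMinimalMatchingCut_image_iff, hc.comap_eq]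

/-- A larger cut of `G` is a lift along a possibly different choice `d`; applying `rep` compares the
two cuts inside the kernel. -/
theorem IsChoice.isMaximalMatchingCut_image_iff (hc : IsChoice G c)
    {M : Set (Sym2 (Fin (keptList G).length))} :
    IsMaximalMatchingCut G (Sym2.map c '' M) ↔ IsMaximalMatchingCut (kernel G) M := by
  have hinj := Sym2.map.injective hc.injective
  unfold IsMaximalMatchingCut
  rw [hc.isMatchingCut_image_iff]
  refine and_congr_right fun _ => ⟨fun h N hN hlt => ?_, fun h N hN hlt => ?_⟩
  · exact h _ (hc.isMatchingCut_image_iff.mpr hN) ((image_ssubset_iff hinj).mpr hlt)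
  · obtain ⟨d, hd, N', rfl⟩ := hN.exists_choice
    have hsub : M ⊆ N' := by
      rw [← Set.image_subset_image_iff (Sym2.map.injective (keep_injective (G := G))),
        ← hc.image_rep, ← hd.image_rep]
      exact Set.image_mono hlt.subset
    refine h N' (hd.isMatchingCut_image_iff.mp hN) (hsub.ssubset_of_ne ?_)
    rintro rfl
    -- Lifts of the same cut have the same number of edges, so none properly contains another.
    refine hlt.ne (Set.eq_of_subset_of_ncard_le hlt.subset ?_ (Set.toFinite _))
    rw [Set.ncard_image_of_injective _ hinj,
      Set.ncard_image_of_injective _ (Sym2.map.injective hd.injective)]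

/-! ### The size and the parameter of the kernel -/

theorem neighborhoodDiversity_le (G : SimpleGraph (Fin n)) : neighborhoodDiversity G ≤ n := by
  refine Nat.sInf_le ⟨⊥, fun U hU => ?_, by simp⟩
  obtain ⟨v, -, rfl⟩ := Finpartition.mem_bot_iff.mp hU
  exact ⟨fun w _ => by simpa using Classical.em _, Or.inl (by simp)⟩

theorem length_keptList_le (G : SimpleGraph (Fin n)) :
    (keptList G).length ≤ 3 * neighborhoodDiversity G := by
  obtain ⟨P, hP, hcard⟩ := Nat.sInf_mem (s := {k | ∃ P : Finpartition (Finset.univ : Finset (Fin n)),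
    IsNeighborhoodDecomposition G P ∧ P.parts.card = k}) ⟨_, ⊥, fun U hU => by
      obtain ⟨v, -, rfl⟩ := Finpartition.mem_bot_iff.mp hU
      exact ⟨fun w _ => by simpa using Classical.em _, Or.inl (by simp)⟩, rfl⟩
  change P.parts.card = neighborhoodDiversity G at hcard
  have htwin : ∀ U ∈ P.parts, ∀ u ∈ U, ∀ v ∈ U, Twin G u v := by
    intro U hU u hu v hv w hwu hwv
    obtain ⟨hm, hci⟩ := hP U hU
    by_cases hw : w ∈ U
    · rcases hci with hc | hi
      · exact iff_of_true (hc hu hw hwu.symm) (hc hv hw hwv.symm)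
      · exact iff_of_false (hi hu hw hwu.symm) (hi hv hw hwv.symm)
    · rcases hm w hw with h | h
      · exact iff_of_true (h u hu).symm (h v hv).symm
      · exact iff_of_false (fun e => h u hu e.symm) (fun e => h v hv e.symm)
  -- A kept vertex is determined by its part and its rank, because vertices of one part are twins
  -- and twins have distinct ranks.
  have : Fintype.card (Fin (keptList G).length) ≤ Fintype.card (P.parts × Fin 3) := by
    refine Fintype.card_le_of_injective (fun a =>
      (⟨P.part (keep G a), P.part_mem.mpr (Finset.mem_univ _)⟩,
        ⟨rank G (keep G a), rank_keep_lt a⟩)) ?_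
    intro a b hab
    simp only [Prod.mk.injEq, Subtype.mk.injEq, Fin.mk.injEq] at hab
    refine keep_injective (Twin.eq_of_rank_eq ?_ hab.2)
    refine htwin (P.part (keep G a)) (P.part_mem.mpr (Finset.mem_univ _)) _
      (P.mem_part (Finset.mem_univ _)) _ ?_
    rw [hab.1]
    exact P.mem_part (Finset.mem_univ _)
  simpa [hcard, mul_comm] using this

end Rank

/-! ### Programs with bounded loops -/

/-- Programs without output whose loops count up to the value of a register. -/
inductive ForProg : Type
  | skip : ForProg
  | assign : ℕ → Expr → ForProg
  | store : ℕ → Expr → Expr → ForProg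
  | write : Expr → ForProg
  | seq : ForProg → ForProg → ForProg
  | cond : Expr → ForProg → ForProg → ForProg
  | upTo : ℕ → ℕ → ForProg → ForProg

namespace ForProg

/-- The translation into a program. -/
def compile : ForProg → Prog
  | skip => .skip
  | assign i e => .assign i e
  | store a i e => .store a i e
  | write e => .write e
  | seq p q => .seq p.compile q.compile
  | cond e p q => .cond e p.compile q.compile
  | .upTo i r p => .seq (.assign i (.const 0))
      (.loop (.lt (.reg i) (.reg r)) (.seq p.compile (.assign i (.add (.reg i) (.const 1)))))

/-- The state after `k` rounds of a loop with counter `i` and body `f`. -/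
def iter (i : ℕ) (f : State → State) (σ : State) : ℕ → State
  | 0 => σ.setReg i 0
  | k + 1 => (f (iter i f σ k)).setReg i (k + 1)

/-- The final state of a computation. -/
def denote : ForProg → State → State
  | skip, σ => σ
  | assign i e, σ => σ.setReg i (e.eval σ)
  | store a i e, σ => σ.setArr a (i.eval σ) (e.eval σ)
  | write e, σ => { σ with buf := σ.buf ++ [decide (e.eval σ ≠ 0)] }
  | seq p q, σ => q.denote (p.denote σ)
  | cond e p q, σ => if e.eval σ ≠ 0 then p.denote σ else q.denote σ
  | .upTo i r p, σ => iter i p.denote σ (σ.reg r)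

/-- The registers that a program may change. -/
def regs : ForProg → List ℕ
  | skip | store _ _ _ | write _ => []
  | assign i _ => [i]
  | seq p q | cond _ p q => p.regs ++ q.regs
  | .upTo i _ p => i :: p.regs

/-- The arrays that a program may change. -/
def arrs : ForProg → List ℕ
  | skip | assign _ _ | write _ => []
  | store a _ _ => [a]
  | seq p q | cond _ p q => p.arrs ++ q.arrs
  | .upTo _ _ p => p.arrs

/-- The program does not write to the buffer. -/
def Quiet : ForProg → Prop
  | skip | assign _ _ | store _ _ _ => True
  | write _ => False
  | seq p q | cond _ p q => p.Quiet ∧ q.Quiet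
  | .upTo _ _ p => p.Quiet

/-- The bounds of all loops are registers in `S`, which the program does not change, and loops do
not change their counters. -/
def WellFormed (S : List ℕ) : ForProg → Prop
  | skip | store _ _ _ | write _ => True
  | assign i _ => i ∉ S
  | seq p q | cond _ p q => p.WellFormed S ∧ q.WellFormed S
  | .upTo i r p => i ∉ S ∧ r ∈ S ∧ i ∉ p.regs ∧ p.WellFormed S

instance decidableQuiet : ∀ p : ForProg, Decidable p.Quiet
  | skip => isTrue trivial
  | assign _ _ => isTrue trivial
  | store _ _ _ => isTrue trivial
  | write _ => isFalse id
  | seq p q => @instDecidableAnd _ _ (decidableQuiet p) (decidableQuiet q)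
  | cond _ p q => @instDecidableAnd _ _ (decidableQuiet p) (decidableQuiet q)
  | .upTo _ _ p => decidableQuiet p

instance decidableWellFormed (S : List ℕ) : ∀ p : ForProg, Decidable (p.WellFormed S)
  | skip => isTrue trivial
  | assign i _ => inferInstanceAs (Decidable (i ∉ S))
  | store _ _ _ => isTrue trivial
  | write _ => isTrue trivial
  | seq p q => @instDecidableAnd _ _ (decidableWellFormed S p) (decidableWellFormed S q)
  | cond _ p q => @instDecidableAnd _ _ (decidableWellFormed S p) (decidableWellFormed S q)
  | .upTo i r p =>
    have := decidableWellFormed S p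
    inferInstanceAs (Decidable (i ∉ S ∧ r ∈ S ∧ i ∉ p.regs ∧ p.WellFormed S))

/-- A bound on the running time in terms of a bound on the bounds of the loops. -/
noncomputable def time : ForProg → Polynomial ℕ
  | skip | assign _ _ | store _ _ _ | write _ => 1
  | seq p q => p.time + q.time
  | cond _ p q => 1 + (p.time + q.time)
  | .upTo _ _ p => 2 + Polynomial.X * (p.time + 2)

/-- The states agree except on what the program may change. -/
structure Agree (p : ForProg) (σ τ : State) : Prop where
  reg : ∀ i, i ∉ p.regs → τ.reg i = σ.reg i
  arr : ∀ a, a ∉ p.arrs → τ.arr a = σ.arr a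
  buf : p.Quiet → τ.buf = σ.buf

theorem Agree.trans {p : ForProg} {σ τ υ : State} (h : p.Agree σ τ) (h' : p.Agree τ υ) :
    p.Agree σ υ :=
  ⟨fun i hi => (h'.reg i hi).trans (h.reg i hi), fun a ha => (h'.arr a ha).trans (h.arr a ha),
    fun hq => (h'.buf hq).trans (h.buf hq)⟩

theorem Agree.mono {p q : ForProg} {σ τ : State} (h : p.Agree σ τ) (hr : p.regs ⊆ q.regs)
    (ha : p.arrs ⊆ q.arrs) (hb : q.Quiet → p.Quiet) : q.Agree σ τ :=
  ⟨fun i hi => h.reg i fun h' => hi (hr h'), fun a hi => h.arr a fun h' => hi (ha h'),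
    fun hq => h.buf (hb hq)⟩

theorem agree_setReg {i r : ℕ} {p : ForProg} (σ : State) (v : ℕ) :
    (ForProg.upTo i r p).Agree σ (σ.setReg i v) :=
  ⟨fun j hj => Function.update_of_ne (fun e => hj (by simp [regs, e])) _ _, fun _ _ => rfl,
    fun _ => rfl⟩

theorem agree_for_of_agree {i r : ℕ} {p : ForProg} {σ τ : State} (h : p.Agree σ τ) :
    (ForProg.upTo i r p).Agree σ τ :=
  h.mono (by simp [regs]) (by simp [arrs]) id

/-- The frame rule: facts about memory survive any program that does not mention the cells as
targets. For concrete programs the side conditions are decidable. -/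
theorem agree_denote (p : ForProg) (σ : State) : p.Agree σ (p.denote σ) := by
  induction p generalizing σ with
  | skip => exact ⟨fun _ _ => rfl, fun _ _ => rfl, fun _ => rfl⟩
  | assign i e =>
    exact ⟨fun j hj => Function.update_of_ne (by simpa [regs] using hj) _ _, fun _ _ => rfl,
      fun _ => rfl⟩
  | store a i e =>
    exact ⟨fun _ _ => rfl, fun j hj => Function.update_of_ne (by simpa [arrs] using hj) _ _,
      fun _ => rfl⟩
  | write e => exact ⟨fun _ _ => rfl, fun _ _ => rfl, fun h => h.elim⟩
  | seq p q ihp ihq =>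
    exact ((ihp σ).mono (by simp [regs]) (by simp [arrs]) And.left).trans
      ((ihq _).mono (by simp [regs]) (by simp [arrs]) And.right)
  | cond e p q ihp ihq =>
    rw [denote]
    split_ifs
    · exact (ihp σ).mono (by simp [regs]) (by simp [arrs]) And.left
    · exact (ihq σ).mono (by simp [regs]) (by simp [arrs]) And.right
  | upTo i r p ih =>
    rw [denote]
    generalize σ.reg r = k
    induction k with
    | zero => exact agree_setReg _ _
    | succ k ihk =>
      exact ihk.trans ((agree_for_of_agree (ih _)).trans (agree_setReg _ _))

theorem iter_reg (i : ℕ) (f : State → State) (σ : State) (k : ℕ) : (iter i f σ k).reg i = k := by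
  cases k <;> exact Function.update_self _ _ _

theorem agree_iter (i r : ℕ) (p : ForProg) (σ : State) (k : ℕ) :
    (ForProg.upTo i r p).Agree σ (iter i p.denote σ k) := by
  induction k with
  | zero => exact agree_setReg _ _
  | succ k ihk =>
    exact ihk.trans ((agree_for_of_agree (agree_denote p _)).trans (agree_setReg _ _))

/-- The invariant rule for loops. -/
theorem for_induct {i r : ℕ} {p : ForProg} {σ : State} (I : ℕ → State → Prop)
    (h0 : I 0 (σ.setReg i 0))
    (hs : ∀ k < σ.reg r, ∀ τ, (ForProg.upTo i r p).Agree σ τ → τ.reg i = k → I k τ →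
      I (k + 1) ((p.denote τ).setReg i (k + 1))) :
    I (σ.reg r) ((ForProg.upTo i r p).denote σ) := by
  have : ∀ k ≤ σ.reg r, I k (iter i p.denote σ k) := by
    intro k
    induction k with
    | zero => exact fun _ => h0
    | succ k ih => exact fun hk => hs k hk _ (agree_iter _ _ _ _ _) (iter_reg _ _ _ _) (ih (by omega))
  exact this _ le_rfl

theorem reg_not_mem_of_wellFormed {S : List ℕ} {p : ForProg} (h : p.WellFormed S) {r : ℕ}
    (hr : r ∈ S) : r ∉ p.regs := by
  induction p with
  | skip | store | write => simp [regs]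
  | assign i e => simp only [WellFormed] at h; simp only [regs, List.mem_singleton]; grind
  | seq p q ihp ihq | cond e p q ihp ihq =>
    simp only [regs, List.mem_append, not_or]; exact ⟨ihp h.1, ihq h.2⟩
  | upTo i s p ih =>
    simp only [regs, List.mem_cons, not_or]
    exact ⟨fun e => h.1 (e ▸ hr), ih h.2.2.2⟩

end ForProg

/-- The trace has no output. -/
def Silent (tr : Trace) : Prop := ∀ e ∈ tr, e = none

theorem Silent.append {t t' : Trace} (h : Silent t) (h' : Silent t') : Silent (t ++ t') :=
  fun e he => (List.mem_append.mp he).elim (h e) (h' e)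

theorem Silent.cons {t : Trace} (h : Silent t) : Silent (none :: t) := by
  intro e he
  rcases List.mem_cons.mp he with rfl | he
  · rfl
  · exact h e he

theorem silent_singleton : Silent [none] := by simp [Silent]

/-- A silent computation of at most `t` steps. -/
def SilentExec (c : Prog) (σ σ' : State) (t : ℕ) : Prop :=
  ∃ tr, Exec c σ σ' tr ∧ Silent tr ∧ tr.length ≤ t

theorem SilentExec.seq {c d : Prog} {σ τ υ : State} {s t : ℕ} (h : SilentExec c σ τ s)
    (h' : SilentExec d τ υ t) : SilentExec (.seq c d) σ υ (s + t) := by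
  obtain ⟨tr, h1, h2, h3⟩ := h
  obtain ⟨tr', h1', h2', h3'⟩ := h'
  exact ⟨_, .seq h1 h1', h2.append h2', by simp; omega⟩

theorem SilentExec.mono {c : Prog} {σ τ : State} {s t : ℕ} (h : SilentExec c σ τ s)
    (hst : s ≤ t) : SilentExec c σ τ t := by
  obtain ⟨tr, h1, h2, h3⟩ := h
  exact ⟨tr, h1, h2, h3.trans hst⟩

/-- The translation of a program with bounded loops runs in polynomial time. -/
theorem ForProg.silentExec {S : List ℕ} {B : ℕ} (p : ForProg) (hp : p.WellFormed S) (σ : State)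
    (hB : ∀ r ∈ S, σ.reg r ≤ B) : SilentExec p.compile σ (p.denote σ) (p.time.eval B) := by
  induction p generalizing σ with
  | skip => exact ⟨_, .skip σ, silent_singleton, by simp [time]⟩
  | assign i e => exact ⟨_, .assign σ i e, silent_singleton, by simp [time]⟩
  | store a i e => exact ⟨_, .store σ a i e, silent_singleton, by simp [time]⟩
  | write e => exact ⟨_, .write σ e, silent_singleton, by simp [time]⟩
  | seq p q ihp ihq =>
    rw [time, Polynomial.eval_add]
    refine (ihp hp.1 σ hB).seq (ihq hp.2 _ fun r hr => ?_)
    rw [(agree_denote p σ).reg r (reg_not_mem_of_wellFormed hp.1 hr)]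
    exact hB r hr
  | cond e p q ihp ihq =>
    simp only [time, Polynomial.eval_add, Polynomial.eval_one]
    by_cases he : e.eval σ = 0
    · obtain ⟨tr, h1, h2, h3⟩ := ihq hp.2 σ hB
      refine ⟨_, .cond_false he ?_, h2.cons, ?_⟩
      · simpa [denote, he] using h1
      · simp; omega
    · obtain ⟨tr, h1, h2, h3⟩ := ihp hp.1 σ hB
      refine ⟨_, .cond_true he ?_, h2.cons, ?_⟩
      · simpa [denote, he] using h1
      · simp; omega
  | upTo i r p ih =>
    obtain ⟨hiS, hrS, hip, hpS⟩ := hp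
    set N := σ.reg r with hN
    have hir : r ∉ (ForProg.upTo i r p).regs :=
      reg_not_mem_of_wellFormed (p := .upTo i r p) ⟨hiS, hrS, hip, hpS⟩ hrS
    have hreg : ∀ k, ∀ s ∈ S, (iter i p.denote σ k).reg s = σ.reg s := fun k s hs =>
      (agree_iter i r p σ k).reg s
        (reg_not_mem_of_wellFormed (p := .upTo i r p) ⟨hiS, hrS, hip, hpS⟩ hs)
    -- Induction on the number `d` of remaining rounds. A round costs the body and two more steps,
    -- the test and the increment; the final 1 is the failing test.
    have loop : ∀ d k, k + d = N → SilentExec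
        (.loop (.lt (.reg i) (.reg r)) (.seq p.compile (.assign i (.add (.reg i) (.const 1)))))
        (iter i p.denote σ k) (iter i p.denote σ N) (1 + d * (p.time.eval B + 2)) := by
      intro d
      induction d with
      | zero =>
        intro k hk
        obtain rfl : k = N := by omega
        refine ⟨_, .loop_done ?_, silent_singleton, by simp⟩
        simp [Expr.eval, iter_reg, hreg _ r hrS, ← hN]
      | succ d ihd =>
        intro k hk
        obtain ⟨tr, h1, h2, h3⟩ := ihd (k + 1) (by omega)
        obtain ⟨tr', h1', h2', h3'⟩ := ih hpS (iter i p.denote σ k) fun s hs => by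
          rw [hreg k s hs]; exact hB s hs
        have hstep : Exec (.assign i (.add (.reg i) (.const 1))) (p.denote (iter i p.denote σ k))
            (iter i p.denote σ (k + 1)) [none] := by
          convert Exec.assign _ _ _ using 1
          simp [iter, Expr.eval, (agree_denote p _).reg i hip, iter_reg]
        refine ⟨_, .loop_step ?_ (.seq h1' hstep) h1,
          ((h2'.append silent_singleton).append h2).cons, ?_⟩
        · simp [Expr.eval, iter_reg, hreg _ r hrS, ← hN]; omega
        · simp only [List.length_cons, List.length_append, List.length_nil]
          nlinarith
    obtain ⟨tr, h1, h2, h3⟩ := loop N 0 (by omega)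
    refine ⟨_, .seq (.assign σ i (.const 0)) h1, silent_singleton.append h2, ?_⟩
    have := Nat.mul_le_mul_right (p.time.eval B + 2) (hB r hrS)
    rw [← hN] at this
    simp [time]
    omega

/-! ### Expressions and loops that occur often -/

namespace Expr

/-- Conjunction. -/
def and (e f : Expr) : Expr := .lt (.const 1) (.add (.lt (.const 0) e) (.lt (.const 0) f))

/-- Negation. -/
def not (e : Expr) : Expr := .eq e (.const 0)

variable (σ : State) (e f : Expr)

theorem eval_and : (e.and f).eval σ ≠ 0 ↔ e.eval σ ≠ 0 ∧ f.eval σ ≠ 0 := by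
  simp only [and, eval]
  by_cases h1 : e.eval σ = 0 <;> by_cases h2 : f.eval σ = 0 <;>
    simp [h1, h2, Nat.pos_iff_ne_zero]

theorem eval_not : e.not.eval σ ≠ 0 ↔ e.eval σ = 0 := by
  simp only [not, eval]; split_ifs <;> simp_all

theorem eval_not_eq : e.not.eval σ = if e.eval σ = 0 then 1 else 0 := rfl

theorem eval_eq : (Expr.eq e f).eval σ ≠ 0 ↔ e.eval σ = f.eval σ := by simp [eval]

theorem eval_lt : (Expr.lt e f).eval σ ≠ 0 ↔ e.eval σ < f.eval σ := by simp [eval]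

theorem eval_or : (Expr.add e f).eval σ ≠ 0 ↔ e.eval σ ≠ 0 ∨ f.eval σ ≠ 0 := by
  simp only [eval]; omega

@[simp] theorem eval_const (c : ℕ) : (Expr.const c).eval σ = c := rfl

@[simp] theorem eval_reg (i : ℕ) : (Expr.reg i).eval σ = σ.reg i := rfl

@[simp] theorem eval_get (a : ℕ) : (Expr.get a e).eval σ = σ.arr a (e.eval σ) := rfl

@[simp] theorem eval_add : (Expr.add e f).eval σ = e.eval σ + f.eval σ := rfl

end Expr

@[simp] theorem State.setReg_reg_self (σ : State) (i v : ℕ) : (σ.setReg i v).reg i = v :=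
  Function.update_self _ _ _

theorem State.setReg_reg_of_ne (σ : State) {i j : ℕ} (v : ℕ) (h : j ≠ i) :
    (σ.setReg i v).reg j = σ.reg j := Function.update_of_ne h _ _

@[simp] theorem State.setReg_arr (σ : State) (i v : ℕ) : (σ.setReg i v).arr = σ.arr := rfl

@[simp] theorem State.setReg_buf (σ : State) (i v : ℕ) : (σ.setReg i v).buf = σ.buf := rfl

@[simp] theorem State.setArr_reg (σ : State) (a i v : ℕ) : (σ.setArr a i v).reg = σ.reg := rfl

theorem State.setArr_arr_self (σ : State) (a i v j : ℕ) :
    (σ.setArr a i v).arr a j = if j = i then v else σ.arr a j := by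
  simp [State.setArr, Function.update_apply]

namespace ForProg

/-- Count in register `acc` the values of `w` below the bound for which `e` holds. -/
def count (acc w r : ℕ) (e : Expr) : ForProg :=
  .seq (.assign acc (.const 0))
    (.upTo w r (.cond e (.assign acc (.add (.reg acc) (.const 1))) .skip))

/-- The test `e` is evaluated in intermediate states, so its meaning is required in all states that
differ from `σ` only in what counting may change. -/
theorem count_spec {acc w r n : ℕ} {e : Expr} {σ : State} (haw : acc ≠ w) (har : acc ≠ r)
    (hn : σ.reg r = n) (P : Fin n → Prop) [DecidablePred P]
    (h : ∀ τ, (count acc w r e).Agree σ τ → ∀ k : Fin n, τ.reg w = k → (e.eval τ ≠ 0 ↔ P k)) :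
    ((count acc w r e).denote σ).reg acc = (Finset.univ.filter P).card := by
  have hr : (σ.setReg acc 0).reg r = n := by rw [State.setReg_reg_of_ne _ _ har.symm, hn]
  have key := for_induct (i := w) (r := r) (σ := σ.setReg acc 0)
    (p := .cond e (.assign acc (.add (.reg acc) (.const 1))) .skip)
    (fun k τ => τ.reg acc = (Finset.univ.filter fun u : Fin n => u.val < k ∧ P u).card)
    (by simp [State.setReg_reg_of_ne _ _ haw]) ?_
  · rw [hr] at key
    simpa [count, denote] using key
  · intro k hk τ hτ hw hI
    rw [hr] at hk
    have hagree : (count acc w r e).Agree σ τ := by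
      refine Agree.trans (τ := σ.setReg acc 0) ?_ (hτ.mono (by simp [count, regs])
        (by simp [count, arrs]) (fun h => h.2))
      exact (agree_denote (.assign acc (.const 0)) σ).mono (by simp [count, regs])
        (by simp [count, arrs]) (fun _ => trivial)
    have he := h τ hagree ⟨k, hk⟩ hw
    rw [State.setReg_reg_of_ne _ _ haw]
    by_cases hP : P ⟨k, hk⟩
    · rw [denote, if_pos (he.mpr hP)]
      have : (Finset.univ.filter fun u : Fin n => u.val < k + 1 ∧ P u) =
          insert ⟨k, hk⟩ (Finset.univ.filter fun u : Fin n => u.val < k ∧ P u) := by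
        ext u
        simp only [Finset.mem_filter, Finset.mem_univ, true_and, Finset.mem_insert, Fin.ext_iff]
        constructor
        · rintro ⟨h1, h2⟩
          by_cases hu : u.val = k
          · exact Or.inl hu
          · exact Or.inr ⟨by omega, h2⟩
        · rintro (h1 | ⟨h1, h2⟩)
          · exact ⟨by omega, by rwa [show u = ⟨k, hk⟩ from Fin.ext h1]⟩
          · exact ⟨by omega, h2⟩
      rw [this, Finset.card_insert_of_notMem (by simp)]
      simp [denote, hI]
    · rw [denote, if_neg (by rw [he]; exact hP)]
      have : (Finset.univ.filter fun u : Fin n => u.val < k + 1 ∧ P u) =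
          (Finset.univ.filter fun u : Fin n => u.val < k ∧ P u) := by
        ext u
        simp only [Finset.mem_filter, Finset.mem_univ, true_and]
        constructor
        · rintro ⟨h1, h2⟩
          refine ⟨?_, h2⟩
          by_contra hu
          exact hP (by rwa [show (⟨k, hk⟩ : Fin n) = u from Fin.ext (by simp; omega)])
        · exact fun ⟨h1, h2⟩ => ⟨by omega, h2⟩
      rw [this]
      simpa [denote] using hI

/-- Fill an array. -/
theorem fill_spec {a i r n : ℕ} {p : ForProg} {e : Expr} {σ : State} (hn : σ.reg r = n)
    (F : Fin n → ℕ) (hi : i ∉ p.regs) (ha : a ∉ p.arrs)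
    (h : ∀ τ, (ForProg.upTo i r (.seq p (.store a (.reg i) e))).Agree σ τ → ∀ k : Fin n,
      τ.reg i = k → e.eval (p.denote τ) = F k) (k : Fin n) :
    ((ForProg.upTo i r (.seq p (.store a (.reg i) e))).denote σ).arr a k = F k := by
  have key := for_induct (i := i) (r := r) (σ := σ) (p := .seq p (.store a (.reg i) e))
    (fun j τ => ∀ k : Fin n, k.val < j → τ.arr a k = F k) (by simp) ?_
  · rw [hn] at key; exact key k k.2
  · intro j hj τ hτ hji hI k hk
    rw [hn] at hj
    have h1 := h τ hτ ⟨j, hj⟩ hji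
    simp only [denote, State.setReg_arr, State.setArr_arr_self, Expr.eval_reg]
    rw [(agree_denote p τ).reg i hi, hji]
    split_ifs with hkj
    · rw [h1]; congr 1; exact Fin.ext hkj.symm
    · rw [(agree_denote p τ).arr a ha]; exact hI k (by omega)

theorem div_unique {n i j i' j' : ℕ} (hj : j < n) (hj' : j' < n) (h : i * n + j = i' * n + j') :
    i = i' ∧ j = j' := by
  have hn : 0 < n := by omega
  have h1 : (i * n + j) / n = i := by
    rw [mul_comm, Nat.mul_add_div hn, Nat.div_eq_of_lt hj, add_zero]
  have h2 : (i' * n + j') / n = i' := by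
    rw [mul_comm, Nat.mul_add_div hn, Nat.div_eq_of_lt hj', add_zero]
  have : i = i' := by rw [← h1, ← h2, h]
  subst this
  exact ⟨rfl, by omega⟩

/-- Fill a matrix. -/
theorem fill_matrix_spec {a o i j r n : ℕ} {p : ForProg} {e : Expr} {σ : State}
    (hn : σ.reg r = n) (F : Fin n → Fin n → ℕ) (hij : i ≠ j) (hjr : r ≠ j) (hir : r ≠ i)
    (hi : i ∉ p.regs) (hj : j ∉ p.regs) (hr : r ∉ p.regs) (ha : a ∉ p.arrs) (hoa : o ≠ a)
    (ho' : o ∉ p.arrs) (ho : ∀ k : Fin n, σ.arr o k = k * n)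
    (h : ∀ τ, (ForProg.upTo i r (.upTo j r (.seq p (.store a (.add (.get o (.reg i)) (.reg j)) e)))).Agree
      σ τ → ∀ k l : Fin n, τ.reg i = k → τ.reg j = l → e.eval (p.denote τ) = F k l) (k l : Fin n) :
    ((ForProg.upTo i r (.upTo j r (.seq p (.store a (.add (.get o (.reg i)) (.reg j)) e)))).denote
      σ).arr a (k * n + l) = F k l := by
  have key := for_induct (i := i) (r := r) (σ := σ)
    (p := .upTo j r (.seq p (.store a (.add (.get o (.reg i)) (.reg j)) e)))
    (fun x τ => ∀ k l : Fin n, k.val < x → τ.arr a (k * n + l) = F k l) (by simp) ?_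
  · rw [hn] at key; exact key k l k.2
  intro x hx τ hτ hτi hI
  rw [hn] at hx
  have hτr : τ.reg r = n := by
    rw [hτ.reg r (by simp [regs, hr, hir, hjr]), hn]
  -- The invariant of the inner loop is lexicographic: the rows before `x` and the first `y` entries
  -- of row `x` are filled. Distinct pairs address distinct cells, so nothing is overwritten.
  have key' := for_induct (i := j) (r := r) (σ := τ)
    (p := .seq p (.store a (.add (.get o (.reg i)) (.reg j)) e))
    (fun y υ => ∀ k l : Fin n, (k.val < x ∨ k.val = x ∧ l.val < y) →
      υ.arr a (k * n + l) = F k l) (fun k l hkl => hI k l (by omega)) ?_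
  · rw [hτr] at key'
    intro k l hk
    simp only [State.setReg_arr]
    exact key' k l (by have := l.2; omega)
  intro y hy υ hυ hυj hJ k l hkl
  rw [hτr] at hy
  have hυi : υ.reg i = x := by rw [hυ.reg i (by simp [regs, hi, hij]), hτi]
  have h1 := h υ (hτ.trans (agree_for_of_agree hυ)) ⟨x, hx⟩ ⟨y, hy⟩ hυi hυj
  simp only [denote, State.setReg_arr, State.setArr_arr_self, Expr.eval_add, Expr.eval_get,
    Expr.eval_reg]
  rw [(agree_denote p υ).reg i hi, (agree_denote p υ).reg j hj, (agree_denote p υ).arr o ho', hυi,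
    hυj, hυ.arr o (by simp [arrs, ho', hoa]), hτ.arr o (by simp [arrs, ho', hoa]), ho ⟨x, hx⟩]
  split_ifs with heq
  · obtain ⟨e1, e2⟩ := div_unique l.2 hy heq
    rw [h1, show k = ⟨x, hx⟩ from Fin.ext e1, show l = ⟨y, hy⟩ from Fin.ext e2]
  · rw [(agree_denote p υ).arr a ha]
    refine hJ k l ?_
    rcases hkl with hkl | ⟨h2, h3⟩
    · exact Or.inl hkl
    · refine Or.inr ⟨h2, ?_⟩
      have : l.val ≠ y := fun e => heq (by rw [h2, e])
      omega

end ForProg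

/-! ### Encodings -/

theorem encodeMatrix_eq_flatMap {n : ℕ} (r : Fin n → Fin n → Bool) :
    encodeMatrix r = (List.finRange n).flatMap fun i => (List.finRange n).map (r i) := by
  unfold encodeMatrix
  rw [List.ofFn_mul, List.flatMap, List.ofFn_eq_map]
  congr 1
  refine List.map_congr_left fun i _ => ?_
  rw [List.ofFn_eq_map]
  refine List.map_congr_left fun j _ => ?_
  have e := finProdFinEquiv.symm_apply_apply (i, j)
  rw [finProdFinEquiv_symm_apply, Prod.mk.injEq] at e
  have : (⟨i * n + j, by
      calc i * n + j < (i + 1) * n := by rw [Nat.succ_mul]; omega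
        _ ≤ n * n := Nat.mul_le_mul_right _ i.2⟩ : Fin (n * n)) = finProdFinEquiv (i, j) := by
    ext; simp [finProdFinEquiv_apply_val]; ring
  rw [this, e.1, e.2]

theorem encodeMatrix_getD {n : ℕ} (r : Fin n → Fin n → Bool) (i j : Fin n) :
    (encodeMatrix r).getD (i * n + j) false = r i j := by
  have hlt : i.val * n + j < n * n := by
    calc i.val * n + j < (i + 1) * n := by rw [Nat.succ_mul]; omega
        _ ≤ n * n := Nat.mul_le_mul_right _ i.2
  have e := finProdFinEquiv.symm_apply_apply (i, j)
  rw [finProdFinEquiv_symm_apply, Prod.mk.injEq] at e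
  have : (⟨i * n + j, hlt⟩ : Fin (n * n)) = finProdFinEquiv (i, j) := by
    ext; simp [finProdFinEquiv_apply_val]; ring
  rw [encodeMatrix, List.getD_eq_getElem?_getD, List.getElem?_ofFn, dif_pos hlt]
  simp only [Option.getD_some]
  rw [this, e.1, e.2]

theorem length_encodeMatrix {n : ℕ} (r : Fin n → Fin n → Bool) :
    (encodeMatrix r).length = n * n := by simp [encodeMatrix]

theorem flatMap_ite {α β : Type*} (p : α → Prop) [DecidablePred p] (f : α → List β) (l : List α) :
    (l.flatMap fun x => if p x then f x else []) = (l.filter fun x => p x).flatMap f := by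
  induction l with
  | nil => rfl
  | cons a l ih => by_cases h : p a <;> simp [h, ih]

theorem map_keep {n : ℕ} (G : SimpleGraph (Fin n)) :
    (List.finRange (keptList G).length).map (keep G) = keptList G := by
  rw [← List.ofFn_eq_map]; exact List.ofFn_get _

-- The vertices of the kernel keep their order, so its matrix arises by skipping the rows and
-- columns of rank at least three. This is what the program writes.
open Classical in
theorem encodeGraph_kernel {n : ℕ} (G : SimpleGraph (Fin n)) :
    encodeGraph (kernel G) = (List.finRange n).flatMap fun i => (List.finRange n).flatMap fun j =>
      if rank G i < 3 ∧ rank G j < 3 then [decide (G.Adj i j)] else [] := by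
  have : ∀ i, ((List.finRange n).flatMap fun j =>
      if rank G i < 3 ∧ rank G j < 3 then [decide (G.Adj i j)] else []) =
      if rank G i < 3 then (keptList G).map (fun j => decide (G.Adj i j)) else [] := by
    intro i
    by_cases h : rank G i < 3
    · simp only [h, true_and, if_true]
      rw [flatMap_ite (fun j => rank G j < 3), List.map_eq_flatMap]
      rfl
    · simp [h]
  simp_rw [this]
  rw [flatMap_ite (fun j => rank G j < 3), encodeGraph, encodeMatrix_eq_flatMap]
  change _ = (keptList G).flatMap _
  conv_rhs => rw [← map_keep G, List.flatMap_map]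
  simp only [List.map_map]
  rfl

/-! ### The kernelization algorithm -/

namespace ForProg

theorem append_spec {i r n : ℕ} {p : ForProg} {σ : State} (hn : σ.reg r = n)
    (g : Fin n → List Bool)
    (h : ∀ τ, (ForProg.upTo i r p).Agree σ τ → ∀ k : Fin n, τ.reg i = k →
      (p.denote τ).buf = τ.buf ++ g k) :
    ((ForProg.upTo i r p).denote σ).buf = σ.buf ++ (List.finRange n).flatMap g := by
  have key := for_induct (i := i) (r := r) (σ := σ) (p := p)
    (fun k τ => τ.buf = σ.buf ++ ((List.finRange n).take k).flatMap g) (by simp) ?_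
  · rw [hn] at key
    rw [key, List.take_of_length_le (by simp)]
  · intro k hk τ hτ hi hI
    rw [hn] at hk
    rw [State.setReg_buf, h τ hτ ⟨k, hk⟩ hi, hI, List.take_succ_eq_append_getElem (by simpa),
      List.flatMap_append]
    simp

/-- Compute in register 3 the least number whose square (in register 4) is at least register 0. -/
def size : ForProg :=
  .upTo 5 0 (.cond (.lt (.reg 4) (.reg 0))
    (.seq (.assign 4 (.add (.reg 4) (.add (.reg 3) (.add (.reg 3) (.const 1)))))
      (.assign 3 (.add (.reg 3) (.const 1)))) .skip)

theorem size_spec {σ : State} (h3 : σ.reg 3 = 0) (h4 : σ.reg 4 = 0) :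
    (size.denote σ).reg 4 = (size.denote σ).reg 3 * (size.denote σ).reg 3 ∧
      (size.denote σ).reg 3 ≤ σ.reg 0 ∧ σ.reg 0 ≤ (size.denote σ).reg 4 ∧
      ∀ m < (size.denote σ).reg 3, m * m < σ.reg 0 := by
  have key := for_induct (i := 5) (r := 0) (σ := σ)
    (p := .cond (.lt (.reg 4) (.reg 0))
      (.seq (.assign 4 (.add (.reg 4) (.add (.reg 3) (.add (.reg 3) (.const 1)))))
      (.assign 3 (.add (.reg 3) (.const 1)))) .skip)
    -- Either the square is already large enough or the root has grown in every round. As `N ≤ N *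
    -- N`, a number of rounds equal to the input length suffices.
    (fun k τ => τ.reg 4 = τ.reg 3 * τ.reg 3 ∧ τ.reg 3 ≤ k ∧ (σ.reg 0 ≤ τ.reg 4 ∨ τ.reg 3 = k) ∧
      ∀ m < τ.reg 3, m * m < σ.reg 0) (by simp [State.setReg, h3, h4]) ?_
  · change (size.denote σ).reg 4 = (size.denote σ).reg 3 * (size.denote σ).reg 3 ∧
      (size.denote σ).reg 3 ≤ σ.reg 0 ∧ (σ.reg 0 ≤ (size.denote σ).reg 4 ∨
      (size.denote σ).reg 3 = σ.reg 0) ∧ ∀ m < (size.denote σ).reg 3, m * m < σ.reg 0 at key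
    obtain ⟨h1, h2, h3, h4⟩ := key
    refine ⟨h1, h2, ?_, h4⟩
    rcases h3 with h3 | h3
    · exact h3
    · rw [h1, h3]; exact Nat.le_mul_self _
  · rintro k hk τ hτ hi ⟨h1, h2, h3, h4⟩
    have h0 : τ.reg 0 = σ.reg 0 := hτ.reg 0 (by decide)
    rw [denote]
    by_cases hlt : τ.reg 4 < τ.reg 0
    · have e3 : τ.reg 3 = k := by omega
      rw [if_pos ((Expr.eval_lt τ (.reg 4) (.reg 0)).mpr hlt)]
      simp only [denote, State.setReg, Expr.eval, Function.update_apply]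
      simp only [Nat.reduceEqDiff, if_true, if_false]
      refine ⟨by rw [h1]; ring, by omega, by omega, fun m hm => ?_⟩
      rcases Nat.lt_succ_iff_lt_or_eq.mp hm with hm | rfl
      · exact h4 m hm
      · omega
    · rw [if_neg (by rw [Expr.eval_lt]; exact hlt)]
      simp only [denote, State.setReg_reg_of_ne _ _ (show 3 ≠ 5 by decide),
        State.setReg_reg_of_ne _ _ (show 4 ≠ 5 by decide)]
      exact ⟨h1, by omega, by omega, h4⟩

theorem size_spec_of_sq {σ : State} {n : ℕ} (h3 : σ.reg 3 = 0) (h4 : σ.reg 4 = 0)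
    (h0 : σ.reg 0 = n * n) : (size.denote σ).reg 3 = n := by
  obtain ⟨h1, -, h3, h4⟩ := size_spec h3 h4
  rw [h0] at h3 h4
  rw [h1] at h3
  refine le_antisymm ?_ (Nat.mul_self_le_mul_self_iff.mp h3)
  by_contra hlt
  exact lt_irrefl _ (h4 n (by omega))

/-- Store the multiples of register `s` in array `o`. -/
def multiples (o s : ℕ) : ForProg :=
  .seq (.assign 9 (.const 0))
    (.upTo 5 3 (.seq (.store o (.reg 5) (.reg 9)) (.assign 9 (.add (.reg 9) (.reg s)))))

theorem multiples_spec {o s n m : ℕ} {σ : State} (hn : σ.reg 3 = n) (hm : σ.reg s = m)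
    (hs9 : s ≠ 9) (hs5 : s ≠ 5) (k : Fin n) :
    ((multiples o s).denote σ).arr o k = k * m := by
  have h3 : (σ.setReg 9 0).reg 3 = n := by rw [State.setReg_reg_of_ne _ _ (by decide), hn]
  have key := for_induct (i := 5) (r := 3) (σ := σ.setReg 9 0)
    (p := .seq (.store o (.reg 5) (.reg 9)) (.assign 9 (.add (.reg 9) (.reg s))))
    (fun k τ => τ.reg 9 = k * m ∧ ∀ l < k, τ.arr o l = l * m)
    (by simp [State.setReg_reg_of_ne _ _ (show 9 ≠ 5 by decide)]) ?_
  · rw [h3] at key; exact key.2 k k.2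
  · rintro k hk τ hτ hi ⟨h1, h2⟩
    have hτs : τ.reg s = m := by
      rw [hτ.reg s (by simp [regs, hs9, hs5]), State.setReg_reg_of_ne _ _ hs9, hm]
    simp only [denote, Expr.eval_reg, Expr.eval_add, State.setReg_arr, State.setArr_reg, hi, h1, hτs,
      State.setReg_reg_of_ne _ _ (show 9 ≠ 5 by decide), State.setReg_reg_self,
      State.setArr_arr_self]
    refine ⟨by ring, fun l hl => ?_⟩
    split_ifs with hlk
    · rw [hlk]
    · exact h2 l (by omega)

/-- The entry of array `a` in row `i` and column `j`. -/
def entry (a i j : ℕ) : Expr := .get a (.add (.get 3 (.reg i)) (.reg j))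

/-- The size of the matrix and the positions where its rows start are known. -/
structure HasSize (n : ℕ) (σ : State) : Prop where
  size : σ.reg 3 = n
  row : ∀ i : Fin n, σ.arr 3 i = i * n

theorem HasSize.of_agree {n : ℕ} {σ τ : State} (h : HasSize n σ) {p : ForProg} (hp : p.Agree σ τ)
    (hr : 3 ∉ p.regs := by decide) (ha : 3 ∉ p.arrs := by decide) : HasSize n τ :=
  ⟨by rw [hp.reg 3 hr, h.size], fun i => by rw [hp.arr 3 ha, h.row]⟩

theorem HasSize.eval_entry {n : ℕ} {σ : State} (h : HasSize n σ) {a i j : ℕ} {k l : Fin n}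
    (hk : σ.reg i = k) (hl : σ.reg j = l) : (entry a i j).eval σ = σ.arr a (k * n + l) := by
  simp [entry, hk, hl, h.row]

open Classical in
/-- The array `a` holds the matrix of a relation. -/
def HasMatrix {n : ℕ} (a : ℕ) (R : Fin n → Fin n → Prop) (σ : State) : Prop :=
  ∀ i j : Fin n, σ.arr a (i * n + j) = if R i j then 1 else 0

theorem HasMatrix.of_agree {n a : ℕ} {R : Fin n → Fin n → Prop} {σ τ : State}
    (h : HasMatrix a R σ) {p : ForProg} (hp : p.Agree σ τ) (ha : a ∉ p.arrs := by decide) :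
    HasMatrix a R τ := fun i j => by rw [hp.arr a ha, h]

theorem HasMatrix.entry_ne_zero {n a : ℕ} {R : Fin n → Fin n → Prop} {σ : State}
    (h : HasMatrix a R σ) (hs : HasSize n σ) {i j : ℕ} {k l : Fin n}
    (hk : σ.reg i = k) (hl : σ.reg j = l) : (entry a i j).eval σ ≠ 0 ↔ R k l := by
  rw [hs.eval_entry hk hl, h]; split_ifs <;> simp_all

/-- The array `a` holds the values of a function. -/
def HasValues {n : ℕ} (a : ℕ) (f : Fin n → ℕ) (σ : State) : Prop := ∀ i : Fin n, σ.arr a i = f i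

theorem HasValues.of_agree {n a : ℕ} {f : Fin n → ℕ} {σ τ : State}
    (h : HasValues a f σ) {p : ForProg} (hp : p.Agree σ τ) (ha : a ∉ p.arrs := by decide) :
    HasValues a f τ := fun i => by rw [hp.arr a ha, h]

/-- Set register 10 to a nonzero number if the matrix in array 0 is not the adjacency matrix of a
graph. -/
def check : ForProg :=
  .seq (.upTo 5 3 (.seq (count 8 6 3 (.add (.not (.eq (entry 0 5 6) (entry 0 6 5)))
    ((Expr.eq (.reg 5) (.reg 6)).and (entry 0 5 6)))) (.store 12 (.reg 5) (.reg 8))))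
  (.seq (count 10 5 3 (.get 12 (.reg 5)))
    (.assign 10 (.add (.reg 10) (.not (.eq (.reg 4) (.reg 0))))))

/-- The register adds up the number of rows with a defect and an indicator that the input length is
not a square, so it vanishes iff there is no defect at all. -/
theorem check_spec {n : ℕ} {R : Fin n → Fin n → Prop} {σ : State} (hs : HasSize n σ)
    (hR : HasMatrix 0 R σ) : (check.denote σ).reg 10 = 0 ↔
      σ.reg 4 = σ.reg 0 ∧ (∀ i j, R i j ↔ R j i) ∧ ∀ i, ¬ R i i := by
  classical
  set τ := denote (.upTo 5 3 (.seq (count 8 6 3 (.add (.not (.eq (entry 0 5 6) (entry 0 6 5)))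
    ((Expr.eq (.reg 5) (.reg 6)).and (entry 0 5 6)))) (.store 12 (.reg 5) (.reg 8)))) σ with hτ
  have hag := agree_denote (.upTo 5 3 (.seq (count 8 6 3
    (.add (.not (.eq (entry 0 5 6) (entry 0 6 5)))
    ((Expr.eq (.reg 5) (.reg 6)).and (entry 0 5 6)))) (.store 12 (.reg 5) (.reg 8)))) σ
  rw [← hτ] at hag
  have hsτ := hs.of_agree hag
  have h12 : HasValues 12 (fun i => (Finset.univ.filter fun j : Fin n =>
      ¬ (R i j ↔ R j i) ∨ i = j ∧ R i j).card) τ := by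
    refine fill_spec hs.size _ (by decide) (by decide) ?_
    intro υ hυ k hk
    refine count_spec (by decide) (by decide) (hs.of_agree hυ).size _ ?_
    intro υ' hυ' l hl
    have hk' : υ'.reg 5 = k := by rw [hυ'.reg 5 (by decide), hk]
    have hs' := (hs.of_agree hυ).of_agree hυ'
    have hR' := (hR.of_agree hυ).of_agree hυ'
    rw [Expr.eval_or, Expr.eval_not, Expr.eval_and, Expr.eval_eq, hR'.entry_ne_zero hs' hk' hl,
      Expr.eval_reg, Expr.eval_reg, hk', hl, Expr.eval, hs'.eval_entry hk' hl,
      hs'.eval_entry hl hk', hR' k l, hR' l k, Fin.val_inj]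
    by_cases h1 : R k l <;> by_cases h2 : R l k <;> simp [h1, h2]
  have h10 : ((count 10 5 3 (.get 12 (.reg 5))).denote τ).reg 10 =
      (Finset.univ.filter fun i : Fin n => (Finset.univ.filter fun j : Fin n =>
      ¬ (R i j ↔ R j i) ∨ i = j ∧ R i j).card ≠ 0).card := by
    refine count_spec (by decide) (by decide) hsτ.size _ ?_
    intro υ hυ k hk
    rw [Expr.eval_get, Expr.eval_reg, hk, h12.of_agree hυ]
  have hag' := agree_denote (count 10 5 3 (.get 12 (.reg 5))) τ
  have e4 : ((count 10 5 3 (.get 12 (.reg 5))).denote τ).reg 4 = σ.reg 4 := by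
    rw [hag'.reg 4 (by decide), hag.reg 4 (by decide)]
  have e0 : ((count 10 5 3 (.get 12 (.reg 5))).denote τ).reg 0 = σ.reg 0 := by
    rw [hag'.reg 0 (by decide), hag.reg 0 (by decide)]
  have : (check.denote σ).reg 10 = ((count 10 5 3 (.get 12 (.reg 5))).denote τ).reg 10 +
      (if (if σ.reg 4 = σ.reg 0 then 1 else 0) = 0 then 1 else 0) := by
    rw [← e4, ← e0, hτ]
    exact State.setReg_reg_self _ _ _
  rw [this, h10]
  have h2 : ((Finset.univ.filter fun i : Fin n => (Finset.univ.filter fun j : Fin n =>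
      ¬ (R i j ↔ R j i) ∨ i = j ∧ R i j).card ≠ 0).card = 0) ↔
      (∀ i j, R i j ↔ R j i) ∧ ∀ i, ¬ R i i := by
    simp only [Finset.card_eq_zero, Finset.filter_eq_empty_iff, Finset.mem_univ, true_implies,
      ne_eq, not_not]
    constructor
    · intro h
      refine ⟨fun i j => ?_, fun i hi => ?_⟩
      · by_contra hc; exact @h i j (Or.inl hc)
      · exact @h i i (Or.inr ⟨rfl, hi⟩)
    · rintro ⟨h1, h2⟩ i j (hc | ⟨rfl, hc⟩)
      · exact hc (h1 i j)
      · exact h2 i hc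
  rw [Nat.add_eq_zero_iff, h2]
  by_cases h : σ.reg 4 = σ.reg 0 <;> simp [h]

/-- Compute the matrix of the twin relation and the ranks. -/
def ranks : ForProg :=
  .seq (.upTo 5 3 (.upTo 6 3 (.seq (count 8 7 3
      ((Expr.not (.eq (.reg 7) (.reg 5))).and ((Expr.not (.eq (.reg 7) (.reg 6))).and
        (.not (.eq (entry 0 5 7) (entry 0 6 7))))))
      (.store 4 (.add (.get 3 (.reg 5)) (.reg 6)) (.not (.reg 8))))))
    (.upTo 5 3 (.seq (count 8 6 3 ((Expr.lt (.reg 6) (.reg 5)).and (entry 4 5 6)))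
      (.store 5 (.reg 5) (.reg 8))))

/-- Twins are recognized by counting the vertices that distinguish a pair and testing whether this
number is zero. -/
theorem ranks_spec {n : ℕ} {G : SimpleGraph (Fin n)} {σ : State} (hs : HasSize n σ)
    (hG : HasMatrix 0 G.Adj σ) :
    HasMatrix 4 (Twin G) (ranks.denote σ) ∧ HasValues 5 (rank G) (ranks.denote σ) := by
  classical
  set p : ForProg := .upTo 5 3 (.upTo 6 3 (.seq (count 8 7 3
      ((Expr.not (.eq (.reg 7) (.reg 5))).and ((Expr.not (.eq (.reg 7) (.reg 6))).and
        (.not (.eq (entry 0 5 7) (entry 0 6 7))))))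
      (.store 4 (.add (.get 3 (.reg 5)) (.reg 6)) (.not (.reg 8))))) with hp
  have ht : HasMatrix 4 (Twin G) (p.denote σ) := by
    refine fill_matrix_spec hs.size (fun i j => if Twin G i j then 1 else 0) (by decide) (by decide)
      (by decide) (by decide) (by decide) (by decide) (by decide) (by decide) (by decide) hs.row ?_
    intro τ hτ k l hk hl
    have hsτ := hs.of_agree hτ
    have hGτ := hG.of_agree hτ
    have := count_spec (acc := 8) (w := 7) (r := 3) (σ := τ)
      (e := (Expr.not (.eq (.reg 7) (.reg 5))).and ((Expr.not (.eq (.reg 7) (.reg 6))).and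
        (.not (.eq (entry 0 5 7) (entry 0 6 7))))) (by decide) (by decide) hsτ.size
      (fun w : Fin n => w ≠ k ∧ w ≠ l ∧ ¬ (G.Adj k w ↔ G.Adj l w)) (by
        intro υ hυ w hw
        have hs' := hsτ.of_agree hυ
        have hG' := hGτ.of_agree hυ
        have hk' : υ.reg 5 = k := by rw [hυ.reg 5 (by decide), hk]
        have hl' : υ.reg 6 = l := by rw [hυ.reg 6 (by decide), hl]
        rw [Expr.eval_and, Expr.eval_and, Expr.eval_not, Expr.eval_not, Expr.eval_not]
        simp only [Expr.eval, hw, hk', hl', hs'.eval_entry hk' hw, hs'.eval_entry hl' hw, hG' k w,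
          hG' l w, Fin.val_inj]
        by_cases h1 : G.Adj k w <;> by_cases h2 : G.Adj l w <;> simp [h1, h2])
    rw [Expr.eval_not_eq, Expr.eval_reg, this]
    refine if_congr ?_ rfl rfl
    simp only [Finset.card_eq_zero, Finset.filter_eq_empty_iff, Finset.mem_univ, true_implies]
    refine ⟨fun h w h1 h2 => by_contra fun h3 => @h w ⟨h1, h2, h3⟩, fun h w hw => ?_⟩
    exact hw.2.2 (h w hw.1 hw.2.1)
  have hsp := hs.of_agree (agree_denote p σ)
  refine ⟨ht.of_agree (agree_denote (.upTo 5 3 (.seq (count 8 6 3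
    ((Expr.lt (.reg 6) (.reg 5)).and (entry 4 5 6))) (.store 5 (.reg 5) (.reg 8)))) _), ?_⟩
  refine fill_spec hsp.size _ (by decide) (by decide) ?_
  intro τ hτ k hk
  have hsτ := hsp.of_agree hτ
  have htτ := ht.of_agree hτ
  refine count_spec (by decide) (by decide) hsτ.size (fun u => u < k ∧ Twin G k u) ?_
  intro υ hυ l hl
  have hk' : υ.reg 5 = k := by rw [hυ.reg 5 (by decide), hk]
  rw [Expr.eval_and, Expr.eval_lt, (htτ.of_agree hυ).entry_ne_zero (hsτ.of_agree hυ) hk' hl,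
    Expr.eval_reg, Expr.eval_reg, hk', hl, Fin.lt_def]

/-- Write the adjacency matrix of the kernel. -/
def writeKernel : ForProg :=
  .upTo 5 3 (.upTo 6 3 (.cond ((Expr.lt (.get 5 (.reg 5)) (.const 3)).and
    (.lt (.get 5 (.reg 6)) (.const 3))) (.write (entry 0 5 6)) .skip))

theorem writeKernel_spec {n : ℕ} {G : SimpleGraph (Fin n)} {σ : State} (hs : HasSize n σ)
    (hG : HasMatrix 0 G.Adj σ) (hr : HasValues 5 (rank G) σ) :
    (writeKernel.denote σ).buf = σ.buf ++ encodeGraph (kernel G) := by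
  classical
  rw [encodeGraph_kernel]
  refine append_spec hs.size _ fun τ hτ k hk => ?_
  have hsτ := hs.of_agree hτ
  refine append_spec hsτ.size _ fun υ hυ l hl => ?_
  have hs' := hsτ.of_agree hυ
  have hG' := (hG.of_agree hτ).of_agree hυ
  have hr' := (hr.of_agree hτ).of_agree hυ
  have hk' : υ.reg 5 = k := by rw [hυ.reg 5 (by decide), hk]
  have hc : ((Expr.lt (.get 5 (.reg 5)) (.const 3)).and
    (.lt (.get 5 (.reg 6)) (.const 3))).eval υ ≠ 0 ↔ rank G k < 3 ∧ rank G l < 3 := by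
    rw [Expr.eval_and, Expr.eval_lt, Expr.eval_lt]
    simp [hk', hl, hr' k, hr' l]
  rw [denote, apply_ite State.buf, if_congr hc rfl rfl]
  split_ifs
  · simp only [denote, hG'.entry_ne_zero hs' hk' hl]
  · simp [denote]

/-- The main part of the kernelization algorithm. -/
def kernelize : ForProg :=
  .seq (multiples 3 3) (.seq check (.cond (.reg 10) .skip (.seq ranks writeKernel)))

end ForProg

/-- The kernelization algorithm. -/
def kernelization : Prog := .seq ForProg.size.compile (.seq ForProg.kernelize.compile .emit)

/-! ### Correctness of the kernelization algorithm -/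

open ForProg

theorem initState_reg_zero (inp : List (List Bool)) {j : ℕ} (h : inp.length ≤ j) :
    (initState inp).reg j = 0 := by
  simp [initState, List.getD_eq_getElem?_getD, List.getElem?_eq_none h]

theorem initState_arr_zero (inp : List (List Bool)) {j : ℕ} (h : inp.length ≤ j) (i : ℕ) :
    (initState inp).arr j i = 0 := by
  simp [initState, List.getD_eq_getElem?_getD, List.getElem?_eq_none h]

theorem outputs_of_silent {tr : Trace} (h : Silent tr) : outputs tr = [] := by
  rw [outputs, List.filterMap_eq_nil_iff]; exact h

theorem outputs_append (s t : Trace) : outputs (s ++ t) = outputs s ++ outputs t := by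
  simp [outputs]

theorem eq_encodeMatrix {n : ℕ} {x : List Bool} (h : x.length = n * n) :
    x = encodeMatrix fun i j : Fin n => x.getD (i * n + j) false := by
  refine List.ext_getElem (by rw [length_encodeMatrix, h]) fun t h1 h2 => ?_
  have ht : t < n * n := h ▸ h1
  have e : t / n * n + t % n = t := by rw [mul_comm, Nat.div_add_mod]
  have : (encodeMatrix fun i j : Fin n => x.getD (i * n + j) false)[t] =
      x.getD (t / n * n + t % n) false := List.getElem_ofFn _
  rw [this, e, List.getD_eq_getElem _ _ h1]

open Classical in
theorem encodeGraph_getD_iff {n : ℕ} (G : SimpleGraph (Fin n)) (i j : Fin n) :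
    (encodeGraph G).getD (i * n + j) false = true ↔ G.Adj i j := by
  rw [encodeGraph, encodeMatrix_getD, decide_eq_true_iff]

theorem length_encodeGraph {n : ℕ} (G : SimpleGraph (Fin n)) :
    (encodeGraph G).length = n * n := length_encodeMatrix _

/-- The state after the size of the matrix has been computed. -/
theorem silentExec_size (inp : List (List Bool)) :
    SilentExec size.compile (initState inp) (size.denote (initState inp))
      (size.time.eval (inp.getD 0 []).length) :=
  silentExec (S := [0]) size (by decide) _ fun r hr => by
    obtain rfl : r = 0 := by simpa using hr
    exact le_rfl

/-- The kernelization algorithm replaces a graph by its kernel and other words by the empty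
word. -/
theorem kernelization_spec (x : List Bool) : ∃ y tr, RunsWith kernelization [x] tr ∧
    outputs tr = [y] ∧ TimeLE tr ((size.time + kernelize.time + 1).eval x.length) ∧
    ((∃ (n : ℕ) (G : SimpleGraph (Fin n)), x = encodeGraph G ∧ y = encodeGraph (kernel G)) ∨
      (¬ ∃ (n : ℕ) (G : SimpleGraph (Fin n)), x = encodeGraph G) ∧ y = []) := by
  classical
  set σ := size.denote (initState [x]) with hσ
  have hag := agree_denote size (initState [x])
  rw [← hσ] at hag
  have hx0 : (initState [x]).reg 0 = x.length := rfl
  have h0 : σ.reg 0 = x.length := by rw [hag.reg 0 (by decide), hx0]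
  have z3 : (initState [x]).reg 3 = 0 := initState_reg_zero _ (by simp)
  have z4 : (initState [x]).reg 4 = 0 := initState_reg_zero _ (by simp)
  obtain ⟨hsq, hle, -, -⟩ := size_spec z3 z4
  rw [← hσ] at hsq hle
  obtain ⟨t1, e1, s1, l1⟩ := silentExec_size [x]
  obtain ⟨t2, e2, s2, l2⟩ := silentExec (S := [0, 3]) (B := x.length) kernelize (by decide) σ
    fun r hr => by
      rcases List.mem_cons.mp hr with rfl | hr
      · exact h0.le
      · obtain rfl : r = 3 := by simpa using hr
        exact hle
  refine ⟨(kernelize.denote σ).buf, t1 ++ (t2 ++ [some _]), ⟨_, e1.seq (e2.seq (.emit _))⟩, ?_,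
    ?_, ?_⟩
  · rw [outputs_append, outputs_append, outputs_of_silent s1, outputs_of_silent s2]; rfl
  · simp only [TimeLE, List.length_append, List.length_singleton, Polynomial.eval_add,
      Polynomial.eval_one]
    have : (([x] : List (List Bool)).getD 0 []).length = x.length := rfl
    rw [this] at l1
    omega
  set n := σ.reg 3 with hn
  -- The relation is read off for every word, encoding or not. Beyond the end of `x` the default
  -- `false` matches the zero cells of the initial state.
  set R : Fin n → Fin n → Prop := fun i j => x.getD (i * n + j) false = true with hR
  set τ := (multiples 3 3).denote σ with hτ
  have hagτ := agree_denote (multiples 3 3) σ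
  rw [← hτ] at hagτ
  have hs : HasSize n τ := ⟨hagτ.reg 3 (by decide), multiples_spec rfl rfl (by decide) (by decide)⟩
  have hm : HasMatrix 0 R τ := by
    intro i j
    rw [hagτ.arr 0 (by decide), hag.arr 0 (by decide)]
    have e : (initState [x]).arr 0 (i * n + j) =
      if x.getD (i * n + j) false = true then 1 else 0 := rfl
    rw [e]
    by_cases hb : x.getD (i * n + j) false = true
    · rw [if_pos hb, if_pos (show R i j from hb)]
    · rw [if_neg hb, if_neg (show ¬ R i j from hb)]
  have hc := check_spec hs hm
  have hagc := agree_denote check τ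
  have hbuf : (check.denote τ).buf = [] := by
    rw [hagc.buf (by decide), hagτ.buf (by decide), hag.buf (by decide)]; rfl
  have e4 : τ.reg 4 = n * n := by rw [hagτ.reg 4 (by decide), hsq]
  have e0 : τ.reg 0 = x.length := by rw [hagτ.reg 0 (by decide), h0]
  rw [e4, e0] at hc
  have hk : kernelize.denote σ = if (check.denote τ).reg 10 ≠ 0 then check.denote τ else
    writeKernel.denote (ranks.denote (check.denote τ)) := rfl
  by_cases h10 : (check.denote τ).reg 10 = 0
  · left
    obtain ⟨hlen, hsymm, hirr⟩ := hc.mp h10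
    obtain ⟨G, hGR⟩ : ∃ G : SimpleGraph (Fin n), G.Adj = R :=
      ⟨⟨R, ⟨fun i j h => (hsymm i j).mp h⟩, ⟨hirr⟩⟩, rfl⟩
    refine ⟨n, G, ?_, ?_⟩
    · rw [eq_encodeMatrix hlen.symm, encodeGraph]
      congr 1
      funext i j
      rw [Bool.eq_iff_iff, decide_eq_true_iff, hGR]
    · rw [hk, if_neg (by simpa using h10)]
      have hs' := hs.of_agree hagc
      have hG : HasMatrix 0 G.Adj (check.denote τ) := hGR ▸ hm.of_agree hagc
      have hagr := agree_denote ranks (check.denote τ)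
      rw [writeKernel_spec (hs'.of_agree hagr) (hG.of_agree hagr) (ranks_spec hs' hG).2,
        hagr.buf (by decide), hbuf, List.nil_append]
  · right
    rw [hk, if_pos h10]
    refine ⟨?_, hbuf⟩
    rintro ⟨m, G, rfl⟩
    -- An encoding has square length, so the computed size is the true number of vertices and the
    -- check cannot fail.
    have hnm : n = m := size_spec_of_sq z3 z4 (by rw [hx0, length_encodeGraph])
    clear_value n
    subst hnm
    refine h10 (hc.mpr ⟨(length_encodeGraph G).symm, fun i j => ?_, fun i => ?_⟩)
    · simp only [hR, encodeGraph_getD_iff, G.adj_comm]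
    · simp only [hR, encodeGraph_getD_iff, G.irrefl, not_false_iff]

/-! ### Positions in the kernel -/

section Positions

variable {n : ℕ} {G : SimpleGraph (Fin n)}

theorem keep_strictMono : StrictMono (keep G) := by
  intro a b hab
  have : (keptList G).Pairwise (· < ·) := (List.pairwise_lt_finRange n).filter _
  exact List.pairwise_iff_get.mp this a b hab

open Classical in
/-- The number of smaller vertices of the kernel. -/
noncomputable def position (G : SimpleGraph (Fin n)) (v : Fin n) : ℕ :=
  (Finset.univ.filter fun u => u < v ∧ rank G u < 3).card

/-- `keep` is increasing, so the index of a kernel vertex is the number of smaller kept vertices,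
which a program can count. -/
theorem position_keep (a : Fin (keptList G).length) : position G (keep G a) = a := by
  classical
  have : (Finset.univ.filter fun u => u < keep G a ∧ rank G u < 3) =
      (Finset.Iio a).map ⟨keep G, keep_injective⟩ := by
    ext u
    simp only [Finset.mem_filter, Finset.mem_univ, true_and, Finset.mem_map, Finset.mem_Iio,
      Function.Embedding.coeFn_mk]
    constructor
    · rintro ⟨h1, h2⟩
      obtain ⟨b, rfl⟩ := exists_keep h2
      exact ⟨b, keep_strictMono.lt_iff_lt.mp h1, rfl⟩
    · rintro ⟨b, hb, rfl⟩
      exact ⟨keep_strictMono hb, rank_keep_lt b⟩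
  rw [position, this, Finset.card_map, Fin.card_Iio]

open Classical in
theorem card_kept : (Finset.univ.filter fun u => rank G u < 3).card = (keptList G).length := by
  have : (Finset.univ.filter fun u => rank G u < 3) =
      Finset.univ.map ⟨keep G, keep_injective⟩ := by
    ext u
    simp only [Finset.mem_filter, Finset.mem_univ, true_and, Finset.mem_map,
      Function.Embedding.coeFn_mk]
    exact ⟨exists_keep, by rintro ⟨b, rfl⟩; exact rank_keep_lt b⟩
  rw [this, Finset.card_map, Finset.card_univ, Fintype.card_fin]

theorem length_keptList_le_card : (keptList G).length ≤ n :=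
  (List.length_filter_le _ _).trans (by simp)

open Classical in
theorem encodeEdges_getD_iff {m : ℕ} (M : Set (Sym2 (Fin m))) (i j : Fin m) :
    (encodeEdges M).getD (i * m + j) false = true ↔ s(i, j) ∈ M := by
  rw [encodeEdges, encodeMatrix_getD, decide_eq_true_iff]

/-- The representative of a vertex if it is incident with an edge of `M`, and otherwise the vertex
itself. -/
noncomputable def activeRep (G : SimpleGraph (Fin n)) (M : Set (Sym2 (Fin n))) (v : Fin n) :
    Fin n := by
  classical exact if Incident M (rep G v) then rep G v else v

open Classical in
/-- The number of smaller elements of the same fiber. -/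
noncomputable def fiberIndex (f : Fin n → Fin n) (v : Fin n) : ℕ :=
  (Finset.univ.filter fun u => u < v ∧ f u = f v).card

open Classical in
/-- The size of a fiber. -/
noncomputable def fiberSize (f : Fin n → Fin n) (v : Fin n) : ℕ :=
  (Finset.univ.filter fun u => f u = v).card

end Positions

/-! ### Preparations of the solution-lifting algorithm -/

namespace ForProg

/-- Compute the positions of the vertices in the kernel. -/
def positions : ForProg :=
  .upTo 5 3 (.seq (count 8 6 3 ((Expr.lt (.reg 6) (.reg 5)).and (.lt (.get 5 (.reg 6)) (.const 3))))
    (.store 14 (.reg 5) (.reg 8)))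

/-- Compute the number of vertices of the kernel. -/
def kernelSize : ForProg := count 12 5 3 (.lt (.get 5 (.reg 5)) (.const 3))

/-- Copy the given matrix to the rows and columns of the vertices of the kernel. -/
def spread : ForProg :=
  .upTo 5 3 (.upTo 6 3 (.seq .skip (.store 6 (.add (.get 3 (.reg 5)) (.reg 6))
    (((Expr.lt (.get 5 (.reg 5)) (.const 3)).and (.lt (.get 5 (.reg 6)) (.const 3))).and
      (.get 2 (.add (.get 13 (.get 14 (.reg 5))) (.get 14 (.reg 6))))))))

/-- Compute the image of the given edge set in the input graph. -/
def readCut : ForProg := .seq positions (.seq kernelSize (.seq (multiples 13 12) spread))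

theorem eval_and_eq (σ : State) (e f : Expr) (P : Prop) [Decidable P]
    (h : (e.and f).eval σ ≠ 0 ↔ P) : (e.and f).eval σ = if P then 1 else 0 := by
  have h01 : (e.and f).eval σ = 0 ∨ (e.and f).eval σ = 1 := by
    rw [Expr.and, Expr.eval]; split_ifs <;> simp
  split_ifs with hP
  · have := h.mpr hP; omega
  · by_contra hc; exact hP (h.mp hc)

/-- The solution is a matrix whose width is the size of the kernel, so its rows start at multiples
of that size. Entries at vertices that are not kept are masked, whatever cell their meaningless
position points to. -/
theorem readCut_spec {n : ℕ} {G : SimpleGraph (Fin n)} {σ : State} (hs : HasSize n σ)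
    (hr : HasValues 5 (rank G) σ) (M : Set (Sym2 (Fin (keptList G).length)))
    (hM : ∀ i, σ.arr 2 i = if (encodeEdges M).getD i false then 1 else 0) :
    HasMatrix 6 (fun i j => s(i, j) ∈ Sym2.map (keep G) '' M) (readCut.denote σ) := by
  classical
  have g1 := agree_denote positions σ
  have hpos : HasValues 14 (position G) (positions.denote σ) := by
    refine fill_spec hs.size _ (by decide) (by decide) fun τ hτ k hk => ?_
    refine count_spec (by decide) (by decide) (hs.of_agree hτ).size _ fun υ hυ l hl => ?_
    have hk' : υ.reg 5 = k := by rw [hυ.reg 5 (by decide), hk]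
    have hr' := (hr.of_agree hτ).of_agree hυ
    rw [Expr.eval_and, Expr.eval_lt, Expr.eval_lt]
    simp [hl, hk', hr' l]
  set σ₁ := positions.denote σ with h1
  have hs1 := hs.of_agree g1
  have hr1 := hr.of_agree g1
  have g2 := agree_denote kernelSize σ₁
  have hlen : (kernelSize.denote σ₁).reg 12 = (keptList G).length := by
    rw [← card_kept]
    refine count_spec (by decide) (by decide) hs1.size _ fun υ hυ l hl => ?_
    have hr' := hr1.of_agree hυ
    rw [Expr.eval_lt]
    simp [hl, hr' l]
  set σ₂ := kernelSize.denote σ₁ with h2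
  have hs2 := hs1.of_agree g2
  have g3 := agree_denote (multiples 13 12) σ₂
  have hmul := multiples_spec (o := 13) hs2.size hlen (by decide) (by decide)
  set σ₃ := (multiples 13 12).denote σ₂ with h3
  have hs3 := hs2.of_agree g3
  have hr3 := (hr1.of_agree g2).of_agree g3
  have hpos3 := (hpos.of_agree g2).of_agree g3
  have hM3 : σ₃.arr 2 = σ.arr 2 := by
    rw [g3.arr 2 (by decide), g2.arr 2 (by decide), g1.arr 2 (by decide)]
  refine fill_matrix_spec hs3.size (fun i j => if s(i, j) ∈ Sym2.map (keep G) '' M then 1 else 0)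
    (by decide) (by decide) (by decide) (by decide) (by decide) (by decide) (by decide) (by decide)
    (by decide) hs3.row fun τ hτ k l hk hl => ?_
  have hr' := hr3.of_agree hτ
  have hp' := hpos3.of_agree hτ
  refine eval_and_eq _ _ _ _ ?_
  rw [Expr.eval_and, Expr.eval_and, Expr.eval_lt, Expr.eval_lt]
  simp only [denote, Expr.eval_get, Expr.eval_reg, Expr.eval_add, Expr.eval_const, hk, hl, hr' k,
    hr' l, hp' k, hp' l]
  constructor
  · rintro ⟨⟨hk3, hl3⟩, he⟩
    obtain ⟨a, rfl⟩ := exists_keep hk3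
    obtain ⟨b, rfl⟩ := exists_keep hl3
    rw [position_keep, position_keep, hτ.arr 13 (by decide), hτ.arr 2 (by decide), hM3,
      hmul ⟨a, a.2.trans_le length_keptList_le_card⟩, hM] at he
    rw [mem_image_map keep_injective, ← encodeEdges_getD_iff]
    by_contra hc
    exact he (if_neg hc)
  · intro hmem
    obtain ⟨⟨a, rfl⟩, ⟨b, rfl⟩⟩ := mem_range_of_mem_image_map hmem
    refine ⟨⟨rank_keep_lt a, rank_keep_lt b⟩, ?_⟩
    rw [position_keep, position_keep, hτ.arr 13 (by decide), hτ.arr 2 (by decide), hM3,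
      hmul ⟨a, a.2.trans_le length_keptList_le_card⟩, hM]
    rw [mem_image_map keep_injective, ← encodeEdges_getD_iff] at hmem
    rw [if_pos hmem]
    exact one_ne_zero

/-- Find the vertices that are incident with the cut. -/
def incident : ForProg :=
  .upTo 5 3 (.seq (count 8 6 3 (entry 6 5 6)) (.store 11 (.reg 5) (.reg 8)))

theorem incident_spec {n : ℕ} {σ : State} (hs : HasSize n σ) {M : Set (Sym2 (Fin n))}
    (hM : HasMatrix 6 (fun i j => s(i, j) ∈ M) σ) (i : Fin n) :
    (incident.denote σ).arr 11 i ≠ 0 ↔ Incident M i := by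
  classical
  have : HasValues 11 (fun i => (Finset.univ.filter fun j => s(i, j) ∈ M).card)
      (incident.denote σ) := by
    refine fill_spec hs.size _ (by decide) (by decide) fun τ hτ k hk => ?_
    refine count_spec (by decide) (by decide) (hs.of_agree hτ).size _ fun υ hυ l hl => ?_
    have hk' : υ.reg 5 = k := by rw [hυ.reg 5 (by decide), hk]
    exact ((hM.of_agree hτ).of_agree hυ).entry_ne_zero ((hs.of_agree hτ).of_agree hυ) hk' hl
  rw [this i, Finset.card_ne_zero]
  simp [Finset.Nonempty, Incident]

/-- Compute the representatives. -/
def representatives : ForProg :=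
  .upTo 5 3 (.seq (.seq (.assign 8 (.reg 5)) (.upTo 6 3
    (.cond (((Expr.lt (.const 2) (.get 5 (.reg 5))).and (entry 4 5 6)).and
      ((Expr.eq (.get 5 (.reg 6)) (.const 2)).and (.get 11 (.reg 6))))
      (.assign 8 (.reg 6)) .skip))) (.store 7 (.reg 5) (.reg 8)))

theorem representatives_spec {n : ℕ} {G : SimpleGraph (Fin n)} {M : Set (Sym2 (Fin n))} {σ : State}
    (hs : HasSize n σ) (ht : HasMatrix 4 (Twin G) σ) (hr : HasValues 5 (rank G) σ)
    (hi : ∀ i : Fin n, σ.arr 11 i ≠ 0 ↔ Incident M i) :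
    HasValues 7 (fun i => (activeRep G M i : ℕ)) (representatives.denote σ) := by
  refine fill_spec hs.size _ (by decide) (by decide) fun τ hτ k hk => ?_
  set P : Fin n → Prop := fun j => (2 < rank G k ∧ Twin G k j) ∧ rank G j = 2 ∧ Incident M j
    with hP
  have hsτ := hs.of_agree hτ
  have key := for_induct (i := 6) (r := 3) (σ := τ.setReg 8 (τ.reg 5))
    (p := .cond (((Expr.lt (.const 2) (.get 5 (.reg 5))).and (entry 4 5 6)).and
      ((Expr.eq (.get 5 (.reg 6)) (.const 2)).and (.get 11 (.reg 6))))
      (.assign 8 (.reg 6)) .skip)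
    -- Either an incident twin of rank two has been found for a `k` of larger rank, or none so far
    -- and `k` still stands for itself. By `rep_eq` whatever is found is the representative.
    (fun x υ => (∃ j : Fin n, P j ∧ υ.reg 8 = j) ∨ (∀ j : Fin n, j.val < x → ¬ P j) ∧ υ.reg 8 = k)
    (Or.inr ⟨by simp, by rw [State.setReg_reg_of_ne _ _ (by decide), State.setReg_reg_self, hk]⟩) ?_
  · rw [State.setReg_reg_of_ne _ _ (by decide), hsτ.size] at key
    change (denote _ (τ.setReg 8 (τ.reg 5))).reg 8 = _
    rcases key with ⟨j, ⟨⟨hk2, htw⟩, hj2, hinc⟩, h8⟩ | ⟨hno, h8⟩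
    · refine h8.trans ?_
      rw [activeRep, rep_eq htw hj2 hk2, if_pos hinc]
    · refine h8.trans ?_
      rw [activeRep]
      split_ifs with hinc
      · by_cases hk2 : 2 < rank G k
        · exact absurd ⟨⟨hk2, twin_rep k⟩, by rw [rank_rep]; omega, hinc⟩
            (hno (rep G k) (rep G k).2)
        · rw [rep_of_rank_lt (by omega)]
      · rfl
  · intro x hx υ hυ h6 hI
    rw [State.setReg_reg_of_ne _ _ (by decide), hsτ.size] at hx
    have hag : (ForProg.upTo 5 3 (.seq (.seq (.assign 8 (.reg 5)) (.upTo 6 3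
      (.cond (((Expr.lt (.const 2) (.get 5 (.reg 5))).and (entry 4 5 6)).and
      ((Expr.eq (.get 5 (.reg 6)) (.const 2)).and (.get 11 (.reg 6))))
      (.assign 8 (.reg 6)) .skip))) (.store 7 (.reg 5) (.reg 8)))).Agree τ υ :=
      ((agree_denote (.assign 8 (.reg 5)) τ).mono (by decide) (by decide) (by decide)).trans
        (hυ.mono (by decide) (by decide) (by decide))
    have h5 : υ.reg 5 = k := by
      rw [hυ.reg 5 (by decide), State.setReg_reg_of_ne _ _ (by decide), hk]
    have hr' := (hr.of_agree hτ).of_agree hag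
    have hc : (((Expr.lt (.const 2) (.get 5 (.reg 5))).and (entry 4 5 6)).and
      ((Expr.eq (.get 5 (.reg 6)) (.const 2)).and (.get 11 (.reg 6)))).eval υ ≠ 0 ↔
      P ⟨x, hx⟩ := by
      have h6' : υ.reg 6 = (⟨x, hx⟩ : Fin n) := h6
      rw [Expr.eval_and, Expr.eval_and, Expr.eval_and, Expr.eval_lt, Expr.eval_eq,
        ((ht.of_agree hτ).of_agree hag).entry_ne_zero (hsτ.of_agree hag) h5 h6']
      simp only [Expr.eval_get, Expr.eval_reg, Expr.eval_const, h5, h6', hr' k, hr' ⟨x, hx⟩,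
        hag.arr 11 (by decide), hτ.arr 11 (by decide), hP]
      rw [← hi]
    rw [State.setReg_reg_of_ne _ _ (by decide), denote]
    by_cases hPx : P ⟨x, hx⟩
    · rw [if_pos (hc.mpr hPx)]
      exact Or.inl ⟨_, hPx, by simp [denote, h6]⟩
    · rw [if_neg (by rw [hc]; exact hPx)]
      rcases hI with hI | ⟨hI, h8⟩
      · exact Or.inl hI
      · refine Or.inr ⟨fun j hj => ?_, h8⟩
        rcases Nat.lt_succ_iff_lt_or_eq.mp hj with hj | hj
        · exact hI j hj
        · rwa [show j = ⟨x, hx⟩ from Fin.ext hj]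

/-- Compute the positions of the vertices in their fibers and the sizes of the fibers. -/
def fibers : ForProg :=
  .seq (.upTo 5 3 (.seq (count 8 6 3 ((Expr.lt (.reg 6) (.reg 5)).and
      (.eq (.get 7 (.reg 6)) (.get 7 (.reg 5))))) (.store 8 (.reg 5) (.reg 8))))
    (.upTo 5 3 (.seq (count 8 6 3 (.eq (.get 7 (.reg 6)) (.reg 5))) (.store 9 (.reg 5) (.reg 8))))

theorem fibers_spec {n : ℕ} {f : Fin n → Fin n} {σ : State} (hs : HasSize n σ)
    (hf : HasValues 7 (fun i => (f i : ℕ)) σ) :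
    HasValues 8 (fiberIndex f) (fibers.denote σ) ∧ HasValues 9 (fiberSize f) (fibers.denote σ) := by
  classical
  have g := agree_denote (.upTo 5 3 (.seq (count 8 6 3 ((Expr.lt (.reg 6) (.reg 5)).and
      (.eq (.get 7 (.reg 6)) (.get 7 (.reg 5))))) (.store 8 (.reg 5) (.reg 8)))) σ
  refine ⟨HasValues.of_agree (p := .upTo 5 3 (.seq (count 8 6 3 (.eq (.get 7 (.reg 6)) (.reg 5)))
    (.store 9 (.reg 5) (.reg 8)))) ?_ (agree_denote _ _), ?_⟩
  · refine fill_spec hs.size _ (by decide) (by decide) fun τ hτ k hk => ?_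
    refine count_spec (by decide) (by decide) (hs.of_agree hτ).size _ fun υ hυ l hl => ?_
    have hk' : υ.reg 5 = k := by rw [hυ.reg 5 (by decide), hk]
    have hf' := (hf.of_agree hτ).of_agree hυ
    rw [Expr.eval_and, Expr.eval_lt, Expr.eval_eq]
    simp [hl, hk', hf' l, hf' k, Fin.val_inj]
  · have hs' := hs.of_agree g
    have hf₁ := hf.of_agree g
    refine fill_spec hs'.size _ (by decide) (by decide) fun τ hτ k hk => ?_
    refine count_spec (by decide) (by decide) (hs'.of_agree hτ).size _ fun υ hυ l hl => ?_
    have hk' : υ.reg 5 = k := by rw [hυ.reg 5 (by decide), hk]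
    have hf' := (hf₁.of_agree hτ).of_agree hυ
    rw [Expr.eval_eq]
    simp [hl, hk', hf' l, Fin.val_inj]

end ForProg

/-! ### Mixed radix numbers -/

section MixedRadix

/-- The number with digits `d` and radices `R`. -/
def radixValue (R d : ℕ → ℕ) (k : ℕ) : ℕ := ∑ v ∈ Finset.range k, d v * ∏ u ∈ Finset.range v, R u

variable {R d d' : ℕ → ℕ}

theorem radixValue_succ (k : ℕ) :
    radixValue R d (k + 1) = radixValue R d k + d k * ∏ u ∈ Finset.range k, R u :=
  Finset.sum_range_succ _ _

theorem radixValue_congr {k : ℕ} (h : ∀ v < k, d v = d' v) : radixValue R d k = radixValue R d' k :=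
  Finset.sum_congr rfl fun v hv => by rw [h v (Finset.mem_range.mp hv)]

theorem radixValue_congr_radix {R' : ℕ → ℕ} {k : ℕ} (h : ∀ v < k, R v = R' v) :
    radixValue R d k = radixValue R' d k := by
  refine Finset.sum_congr rfl fun v hv => ?_
  rw [Finset.prod_congr rfl fun u hu => h u
    ((Finset.mem_range.mp hu).trans (Finset.mem_range.mp hv))]

theorem radixValue_lt {k : ℕ} (h : ∀ v < k, d v < R v) :
    radixValue R d k < ∏ u ∈ Finset.range k, R u := by
  induction k with
  | zero => simp [radixValue]
  | succ k ih =>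
    rw [radixValue_succ, Finset.prod_range_succ]
    have h1 := ih fun v hv => h v (by omega)
    have h2 := Nat.mul_le_mul_left (∏ u ∈ Finset.range k, R u) (h k (by omega))
    rw [Nat.mul_succ, mul_comm _ (d k)] at h2
    omega

/-- The lower digits contribute less than the weight of the top digit, so division with remainder
separates them. -/
theorem eq_of_radixValue_eq {k : ℕ} (h : ∀ v < k, d v < R v) (h' : ∀ v < k, d' v < R v)
    (he : radixValue R d k = radixValue R d' k) : ∀ v < k, d v = d' v := by
  induction k with
  | zero => simp
  | succ k ih =>
    rw [radixValue_succ, radixValue_succ] at he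
    have h1 := radixValue_lt fun v (hv : v < k) => h v (by omega)
    have h2 := radixValue_lt fun v (hv : v < k) => h' v (by omega)
    have := ForProg.div_unique (i := d k) (i' := d' k) h1 h2 (by omega)
    intro v hv
    rcases Nat.lt_succ_iff_lt_or_eq.mp hv with hv | rfl
    · exact ih (fun v hv => h v (by omega)) (fun v hv => h' v (by omega)) this.2 v hv
    · exact this.1

end MixedRadix

/-! ### Delays -/

theorem delayLE_of_length_le {tr : Trace} {t : ℕ} (h : tr.length ≤ t) : DelayLE tr t := by
  rintro pre mid post rfl -
  simp at h
  omega

/-- A stretch without output cannot contain the step that outputs `w`, so it lies inside `s` or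
inside `r`. -/
theorem delayLE_output {s r : Trace} {w : List Bool} {t : ℕ} (hs : s.length ≤ t)
    (hr : DelayLE r t) : DelayLE (s ++ some w :: r) t := by
  intro pre mid post he hm
  rcases List.append_eq_append_iff.mp he with ⟨a, h1, h2⟩ | ⟨c, rfl, -⟩
  · cases a with
    | nil =>
      have := congrArg List.length h1
      simp at this
      omega
    | cons o a =>
      obtain ⟨rfl, rfl⟩ := List.cons.inj h2
      rcases List.append_eq_append_iff.mp h1 with ⟨b, rfl, h3⟩ | ⟨b, rfl, h3⟩
      · exact absurd (hm (some w) (by rw [h3]; simp)) (by simp)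
      · cases b with
        | nil => exact absurd (hm (some w) (by rw [List.nil_append] at h3; rw [← h3]; simp)) (by simp)
        | cons o b =>
          obtain ⟨-, rfl⟩ := List.cons.inj h3
          exact hr b mid post (by simp) hm
  · simp at hs
    omega

/-! ### The enumeration loop -/

/-- The matrix of the lifted cut for the digits `d`. -/
noncomputable def cutWord {n : ℕ} (Q : Fin n → Fin n → Prop) (f : Fin n → Fin n) (idx : Fin n → ℕ)
    (d : ℕ → ℕ) : List Bool := by
  classical exact
  encodeMatrix fun i j => decide (Q (f i) (f j) ∧ d (f i) = idx i ∧ d (f j) = idx j)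

namespace ForProg

/-- The data that is used by the enumeration loop. -/
structure LiftData {n : ℕ} (Q : Fin n → Fin n → Prop) (f : Fin n → Fin n) (idx sz : Fin n → ℕ)
    (σ : State) : Prop where
  size : HasSize n σ
  cut : HasMatrix 6 Q σ
  rep : HasValues 7 (fun i => (f i : ℕ)) σ
  idx : HasValues 8 idx σ
  sz : HasValues 9 sz σ

theorem LiftData.of_agree {n : ℕ} {Q : Fin n → Fin n → Prop} {f : Fin n → Fin n}
    {idx sz : Fin n → ℕ} {σ τ : State} (h : LiftData Q f idx sz σ) {p : ForProg} (hp : p.Agree σ τ)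
    (h3 : 3 ∉ p.regs := by decide) (h3' : 3 ∉ p.arrs := by decide) (h6 : 6 ∉ p.arrs := by decide)
    (h7 : 7 ∉ p.arrs := by decide) (h8 : 8 ∉ p.arrs := by decide)
    (h9 : 9 ∉ p.arrs := by decide) : LiftData Q f idx sz τ :=
  ⟨h.size.of_agree hp h3 h3', h.cut.of_agree hp h6, h.rep.of_agree hp h7, h.idx.of_agree hp h8,
    h.sz.of_agree hp h9⟩

/-- Write the lifted cut for the current digits. -/
def writeCut : ForProg :=
  .upTo 5 3 (.upTo 6 3 (.write ((Expr.get 6 (.add (.get 3 (.get 7 (.reg 5))) (.get 7 (.reg 6)))).and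
    ((Expr.eq (.get 10 (.get 7 (.reg 5))) (.get 8 (.reg 5))).and
      (.eq (.get 10 (.get 7 (.reg 6))) (.get 8 (.reg 6)))))))

theorem writeCut_spec {n : ℕ} {Q : Fin n → Fin n → Prop} {f : Fin n → Fin n}
    {idx sz : Fin n → ℕ} {σ : State} (h : LiftData Q f idx sz σ) :
    (writeCut.denote σ).buf = σ.buf ++ cutWord Q f idx (σ.arr 10) := by
  classical
  rw [cutWord, encodeMatrix_eq_flatMap]
  simp_rw [List.map_eq_flatMap]
  refine append_spec h.size.size _ fun τ hτ k hk => ?_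
  have h1 := h.of_agree hτ
  refine append_spec h1.size.size _ fun υ hυ l hl => ?_
  have h2 := h1.of_agree hυ
  have hk' : υ.reg 5 = k := by rw [hυ.reg 5 (by decide), hk]
  have h10 : υ.arr 10 = σ.arr 10 := by rw [hυ.arr 10 (by decide), hτ.arr 10 (by decide)]
  refine congrArg (fun b => υ.buf ++ [b]) ?_
  rw [decide_eq_decide, Expr.eval_and, Expr.eval_and, Expr.eval_eq, Expr.eval_eq]
  simp only [Expr.eval_get, Expr.eval_reg, Expr.eval_add, hk', hl, h2.rep k, h2.rep l, h2.idx k,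
    h2.idx l, h2.size.row (f k), h2.cut (f k) (f l), h10]
  refine and_congr_left fun _ => ?_
  split_ifs with hc <;> simp [hc]

/-- Proceed to the next digits; register 10 is set to zero if there are none. -/
def advance : ForProg :=
  .seq (.assign 10 (.const 1)) (.seq (.upTo 5 3 (.cond (.reg 10)
    (.cond (.lt (.add (.get 10 (.reg 5)) (.const 1)) (.get 9 (.reg 5)))
      (.seq (.store 10 (.reg 5) (.add (.get 10 (.reg 5)) (.const 1))) (.assign 10 (.const 0)))
      (.store 10 (.reg 5) (.const 0))) .skip)) (.assign 10 (.not (.reg 10))))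

/-- Incrementing with carry, where register 10 is the carry and is negated at the end. The maximum
with 1 gives empty fibers the radix 1, so that their digit is always 0. -/
theorem advance_spec {n : ℕ} {R : ℕ → ℕ} {σ : State} (hn : σ.reg 3 = n)
    (hR : ∀ v, R v = max (σ.arr 9 v) 1) (hd : ∀ v < n, σ.arr 10 v < R v) :
    (∀ v < n, (advance.denote σ).arr 10 v < R v) ∧
    ((advance.denote σ).reg 10 = 1 ∧
        radixValue R ((advance.denote σ).arr 10) n = radixValue R (σ.arr 10) n + 1 ∨
      (advance.denote σ).reg 10 = 0 ∧
        radixValue R (σ.arr 10) n + 1 = ∏ u ∈ Finset.range n, R u) := by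
  have key := for_induct (i := 5) (r := 3) (σ := σ.setReg 10 1)
    (p := (.cond (.reg 10)
    (.cond (.lt (.add (.get 10 (.reg 5)) (.const 1)) (.get 9 (.reg 5)))
      (.seq (.store 10 (.reg 5) (.add (.get 10 (.reg 5)) (.const 1))) (.assign 10 (.const 0)))
      (.store 10 (.reg 5) (.const 0))) .skip))
    -- After `k` digits, the new value together with the carry at weight `∏ u < k, R u` is the old
    -- value plus one, and the higher digits are untouched.
    (fun k τ => (∀ v < n, τ.arr 10 v < R v) ∧ (∀ v, k ≤ v → τ.arr 10 v = σ.arr 10 v) ∧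
      (τ.reg 10 = 0 ∨ τ.reg 10 = 1) ∧
      radixValue R (τ.arr 10) k + τ.reg 10 * ∏ u ∈ Finset.range k, R u =
        radixValue R (σ.arr 10) k + 1)
    ⟨hd, fun _ _ => rfl, by simp [State.setReg_reg_of_ne _ _ (show 10 ≠ 5 by decide)],
      by simp [State.setReg_reg_of_ne _ _ (show 10 ≠ 5 by decide), radixValue]⟩ ?_
  · rw [State.setReg_reg_of_ne _ _ (by decide), hn] at key
    set τ := denote (.upTo 5 3 (.cond (.reg 10)
      (.cond (.lt (.add (.get 10 (.reg 5)) (.const 1)) (.get 9 (.reg 5)))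
      (.seq (.store 10 (.reg 5) (.add (.get 10 (.reg 5)) (.const 1))) (.assign 10 (.const 0)))
      (.store 10 (.reg 5) (.const 0))) .skip)) (σ.setReg 10 1) with hτ
    have ha : (advance.denote σ) = τ.setReg 10 (if τ.reg 10 = 0 then 1 else 0) := rfl
    obtain ⟨h1, -, h3, h4⟩ := key
    rw [ha, State.setReg_arr, State.setReg_reg_self]
    refine ⟨h1, ?_⟩
    rcases h3 with h3 | h3
    · left
      rw [h3] at h4
      exact ⟨if_pos h3, by simpa using h4⟩
    · right
      rw [h3, one_mul] at h4
      have := radixValue_lt hd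
      exact ⟨by rw [h3]; rfl, by omega⟩
  · rintro k hk τ hτ h5 ⟨h1, h2, h3, h4⟩
    rw [State.setReg_reg_of_ne _ _ (by decide), hn] at hk
    have h9 : τ.arr 9 = σ.arr 9 := by rw [hτ.arr 9 (by decide), State.setReg_arr]
    have hk1 := h1 k hk
    rw [radixValue_succ (d := σ.arr 10), radixValue_succ]
    simp only [State.setReg_arr, State.setReg_reg_of_ne _ _ (show 10 ≠ 5 by decide)]
    rw [denote]
    rcases h3 with h3 | h3
    · rw [if_neg (by simp [h3])]
      simp only [denote]
      rw [h3, zero_mul] at h4 ⊢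
      rw [h2 k le_rfl]
      exact ⟨h1, fun v hv => h2 v (by omega), Or.inl rfl, by omega⟩
    · rw [if_pos (by simp [h3]), denote]
      rw [h3, one_mul] at h4
      have e2 := h2 k le_rfl
      by_cases hlt : τ.arr 10 k + 1 < σ.arr 9 k
      · rw [if_pos (by rw [Expr.eval_lt]; simpa [h5, h9] using hlt)]
        simp only [denote, State.setReg_arr, State.setReg_reg_self, State.setArr_arr_self,
          Expr.eval_reg, Expr.eval_add, Expr.eval_get, Expr.eval_const, h5]
        refine ⟨fun v hv => ?_, fun v hv => ?_, Or.inl trivial, ?_⟩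
        · split_ifs with hvk
          · rw [hvk, hR]; omega
          · exact h1 v hv
        · rw [if_neg (by omega)]; exact h2 v (by omega)
        · rw [radixValue_congr (d' := τ.arr 10) fun v hv => by
            rw [State.setArr_arr_self, if_neg (by omega)]]
          simp only [if_true, zero_mul, add_zero]
          rw [e2, add_mul, one_mul]
          omega
      · rw [if_neg (by rw [Expr.eval_lt]; simpa [h5, h9] using hlt)]
        simp only [denote, State.setArr_reg, State.setArr_arr_self, Expr.eval_reg,
          Expr.eval_const, h5, h3]
        refine ⟨fun v hv => ?_, fun v hv => ?_, Or.inr trivial, ?_⟩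
        · split_ifs with hvk
          · rw [hR]; omega
          · exact h1 v hv
        · rw [if_neg (by omega)]; exact h2 v (by omega)
        · rw [radixValue_congr (d' := τ.arr 10) fun v hv => by
            rw [State.setArr_arr_self, if_neg (by omega)]]
          have : R k = σ.arr 10 k + 1 := by
            rw [hR, ← e2]; rw [hR] at hk1; omega
          rw [Finset.prod_range_succ, this]
          simp only [if_true, zero_mul, add_zero, one_mul]
          rw [mul_add, mul_one, mul_comm]
          omega

/-- Output the lifted cuts for all digits from the current ones on. -/
def enumerate : Prog :=
  .loop (.reg 10) (.seq (.seq writeCut.compile .emit) advance.compile)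

/-- The loop lists the lifted cuts for all digits from the current ones on. -/
theorem enumerate_spec {n L : ℕ} {Q : Fin n → Fin n → Prop} {f : Fin n → Fin n}
    {idx sz : Fin n → ℕ} {R : ℕ → ℕ} (hL : n ≤ L) {A : ℕ} (hA : advance.time.eval L ≤ A) (c : ℕ) :
    ∀ σ : State, LiftData Q f idx sz σ → σ.reg 0 = L → (∀ v, R v = max (σ.arr 9 v) 1) →
      (∀ v < n, σ.arr 10 v < R v) → σ.reg 10 = 1 → σ.buf = [] →
      radixValue R (σ.arr 10) n + c = ∏ u ∈ Finset.range n, R u →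
      ∃ σ' tr, ∃ ds : List (ℕ → ℕ), Exec enumerate σ σ' tr ∧
        (∀ d ∈ ds, ∀ v < n, d v < R v) ∧
        ds.map (fun d => radixValue R d n) = List.range' (radixValue R (σ.arr 10) n) c ∧
        outputs tr = ds.map (cutWord Q f idx) ∧
        tr.length ≤ c * (A + writeCut.time.eval L + 2) + 1 ∧
        ∀ s : Trace, s.length ≤ A → DelayLE (s ++ tr) (A + writeCut.time.eval L + 1) := by
  induction c with
  | zero =>
    intro σ _ _ _ hd _ _ hc
    have := radixValue_lt hd
    omega
  | succ c ih =>
    intro σ h h0 hR hd h10 hbuf hc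
    have hreg : ∀ τ : State, τ.reg 0 = L → τ.reg 3 = n → ∀ r ∈ [0, 3], τ.reg r ≤ L := by
      intro τ e0 e3 r hr
      rcases List.mem_cons.mp hr with rfl | hr
      · exact e0.le
      · obtain rfl : r = 3 := by simpa using hr
        exact e3.le.trans hL
    obtain ⟨t1, x1, s1, l1⟩ := silentExec (S := [0, 3]) writeCut (by decide) σ
      (hreg σ h0 h.size.size)
    have g1 := agree_denote writeCut σ
    have hw := writeCut_spec h
    rw [hbuf, List.nil_append] at hw
    set σ₁ : State := { writeCut.denote σ with buf := [] } with hσ₁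
    have x2 : Exec .emit (writeCut.denote σ) σ₁ [some (cutWord Q f idx (σ.arr 10))] := by
      rw [← hw]; exact .emit _
    have a1 : writeCut.Agree σ σ₁ := ⟨g1.reg, g1.arr, fun hq => absurd hq (by decide)⟩
    have d1 := h.of_agree a1
    have e0 : σ₁.reg 0 = L := by rw [a1.reg 0 (by decide), h0]
    have e10 : σ₁.arr 10 = σ.arr 10 := a1.arr 10 (by decide)
    have e9 : σ₁.arr 9 = σ.arr 9 := a1.arr 9 (by decide)
    obtain ⟨t2, x3, s2, l2⟩ := silentExec (S := [0, 3]) advance (by decide) σ₁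
      (hreg σ₁ e0 d1.size.size)
    have a2 := agree_denote advance σ₁
    obtain ⟨v1, v2⟩ := advance_spec (R := R) d1.size.size (fun v => by rw [e9, hR])
      (fun v hv => by rw [e10]; exact hd v hv)
    rw [e10] at v2
    -- the remaining rounds
    have rest : ∃ σ' tr, ∃ ds : List (ℕ → ℕ), Exec enumerate (advance.denote σ₁) σ' tr ∧
        (∀ d ∈ ds, ∀ v < n, d v < R v) ∧
        ds.map (fun d => radixValue R d n) = List.range' (radixValue R (σ.arr 10) n + 1) c ∧
        outputs tr = ds.map (cutWord Q f idx) ∧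
        tr.length ≤ c * (A + writeCut.time.eval L + 2) + 1 ∧
        ∀ s : Trace, s.length ≤ A → DelayLE (s ++ tr) (A + writeCut.time.eval L + 1) := by
      rcases v2 with ⟨w1, w2⟩ | ⟨w1, w2⟩
      · rw [← w2]
        refine ih _ (d1.of_agree a2) (by rw [a2.reg 0 (by decide), e0])
          (fun v => by rw [a2.arr 9 (by decide), e9, hR]) v1 w1 (by rw [a2.buf (by decide)])
          (by rw [w2]; omega)
      · have hc0 : c = 0 := by omega
        subst hc0
        refine ⟨_, [none], [], .loop_done (by simpa using w1), by simp, by simp, rfl, by simp,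
          fun s hs => delayLE_of_length_le ?_⟩
        simp
        omega
    obtain ⟨σ', tr, ds, y1, y2, y3, y4, y5, y6⟩ := rest
    refine ⟨σ', none :: ((t1 ++ [some (cutWord Q f idx (σ.arr 10))]) ++ t2 ++ tr),
      σ.arr 10 :: ds, .loop_step (by simp [h10]) ((x1.seq x2).seq x3) y1, ?_, ?_, ?_, ?_, ?_⟩
    · intro d hd'
      rcases List.mem_cons.mp hd' with rfl | hd'
      · exact hd
      · exact y2 d hd'
    · rw [List.map_cons, y3, List.range'_succ]
    · change outputs ([none] ++ ((t1 ++ [some (cutWord Q f idx (σ.arr 10))]) ++ t2 ++ tr)) = _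
      rw [outputs_append, outputs_append, outputs_append, outputs_append, outputs_of_silent s1,
        outputs_of_silent s2, outputs_of_silent silent_singleton, y4]
      rfl
    · simp only [List.length_cons, List.length_append, List.length_nil]
      rw [Nat.succ_mul]
      omega
    -- Here `s` is the silent stretch before this round, that is, the preparations or the preceding
    -- increment. Together with the test and the writing it makes one delay; the increment of this
    -- round becomes the prefix for the rest.
    · intro s hs
      have : s ++ none :: ((t1 ++ [some (cutWord Q f idx (σ.arr 10))]) ++ t2 ++ tr) =
          (s ++ none :: t1) ++ some (cutWord Q f idx (σ.arr 10)) :: (t2 ++ tr) := by simp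
      rw [this]
      refine delayLE_output ?_ (y6 t2 (l2.trans hA))
      simp
      omega

/-- The preparations of the solution-lifting algorithm. -/
def prepare : ForProg :=
  .seq (multiples 3 3) (.seq ranks (.seq readCut (.seq incident (.seq representatives
    (.seq fibers (.assign 10 (.const 1)))))))

theorem prepare_spec {n : ℕ} {G : SimpleGraph (Fin n)} {σ : State} (hn : σ.reg 3 = n)
    (hG : HasMatrix 0 G.Adj σ) (M : Set (Sym2 (Fin (keptList G).length)))
    (hM : ∀ i, σ.arr 2 i = if (encodeEdges M).getD i false then 1 else 0) :
    LiftData (fun i j => s(i, j) ∈ Sym2.map (keep G) '' M) (activeRep G (Sym2.map (keep G) '' M))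
      (fiberIndex (activeRep G (Sym2.map (keep G) '' M)))
      (fiberSize (activeRep G (Sym2.map (keep G) '' M))) (prepare.denote σ) ∧
    (prepare.denote σ).reg 10 = 1 := by
  have g1 := agree_denote (multiples 3 3) σ
  have s1 : HasSize n ((multiples 3 3).denote σ) :=
    ⟨by rw [g1.reg 3 (by decide), hn], multiples_spec hn hn (by decide) (by decide)⟩
  have G1 := hG.of_agree g1
  set σ₁ := (multiples 3 3).denote σ with h1
  have g2 := agree_denote ranks σ₁
  obtain ⟨t2, r2⟩ := ranks_spec s1 G1
  set σ₂ := ranks.denote σ₁ with h2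
  have s2 := s1.of_agree g2
  have g3 := agree_denote readCut σ₂
  have c3 := readCut_spec s2 r2 M fun i => by rw [g2.arr 2 (by decide), g1.arr 2 (by decide), hM]
  set σ₃ := readCut.denote σ₂ with h3
  have s3 := s2.of_agree g3
  have g4 := agree_denote incident σ₃
  have i4 := incident_spec s3 c3
  set σ₄ := incident.denote σ₃ with h4
  have s4 := s3.of_agree g4
  have g5 := agree_denote representatives σ₄
  have f5 := representatives_spec s4 ((t2.of_agree g3).of_agree g4) ((r2.of_agree g3).of_agree g4) i4
  set σ₅ := representatives.denote σ₄ with h5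
  have s5 := s4.of_agree g5
  have g6 := agree_denote fibers σ₅
  obtain ⟨i6, z6⟩ := fibers_spec s5 f5
  set σ₆ := fibers.denote σ₅ with h6
  have g7 := agree_denote (.assign 10 (.const 1)) σ₆
  refine ⟨⟨(s5.of_agree g6).of_agree g7, ?_, (f5.of_agree g6).of_agree g7, i6.of_agree g7,
    z6.of_agree g7⟩, State.setReg_reg_self _ _ _⟩
  exact (((c3.of_agree g4).of_agree g5).of_agree g6).of_agree g7

end ForProg
/-- The solution-lifting algorithm. -/
def lifting : Prog := .seq size.compile (.seq prepare.compile enumerate)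

/-- A bound for the delays of the solution-lifting algorithm. -/
noncomputable def liftingDelay : Polynomial ℕ :=
  size.time + prepare.time + advance.time + writeCut.time + 2

/-- The solution-lifting algorithm lists the lifted cuts for all digits. -/
theorem lifting_spec {n : ℕ} (G : SimpleGraph (Fin n))
    (M : Set (Sym2 (Fin (keptList G).length))) (y : List Bool) {f : Fin n → Fin n}
    (hf : f = activeRep G (Sym2.map (keep G) '' M)) {R : ℕ → ℕ}
    (hR : ∀ v : Fin n, R v = max (fiberSize f v) 1) :
    ∃ tr, ∃ ds : List (ℕ → ℕ), RunsWith lifting [encodeGraph G, y, encodeEdges M] tr ∧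
      (∀ d ∈ ds, ∀ v < n, d v < R v) ∧
      ds.map (fun d => radixValue R d n) = List.range (∏ u ∈ Finset.range n, R u) ∧
      outputs tr = ds.map
        (cutWord (fun i j => s(i, j) ∈ Sym2.map (keep G) '' M) f (fiberIndex f)) ∧
      tr.length ≤ (∏ u ∈ Finset.range n, R u + 1) * liftingDelay.eval (n * n) ∧
      DelayLE tr (liftingDelay.eval (n * n)) := by
  subst hf
  set inp := [encodeGraph G, y, encodeEdges M] with hinp
  have z3 : (initState inp).reg 3 = 0 := initState_reg_zero _ (by simp [hinp])
  have z4 : (initState inp).reg 4 = 0 := initState_reg_zero _ (by simp [hinp])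
  have hx0 : (initState inp).reg 0 = n * n := length_encodeGraph G
  obtain ⟨t1, e1, s1, l1⟩ := silentExec_size inp
  rw [show (inp.getD 0 []).length = n * n from hx0] at l1
  have g1 := agree_denote size (initState inp)
  have h3 : (size.denote (initState inp)).reg 3 = n := size_spec_of_sq z3 z4 hx0
  set σ := size.denote (initState inp) with hσ
  have h0 : σ.reg 0 = n * n := by rw [g1.reg 0 (by decide), hx0]
  obtain ⟨t2, e2, s2, l2⟩ := silentExec (S := [0, 3]) (B := n * n) prepare (by decide) σ
    fun r hr => by
      rcases List.mem_cons.mp hr with rfl | hr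
      · exact h0.le
      · obtain rfl : r = 3 := by simpa using hr
        exact h3.le.trans (Nat.le_mul_self n)
  have hG : HasMatrix 0 G.Adj σ := by
    intro i j
    rw [g1.arr 0 (by decide)]
    have e : (initState inp).arr 0 (i * n + j) =
      if (encodeGraph G).getD (i * n + j) false = true then 1 else 0 := rfl
    rw [e]
    by_cases hb : G.Adj i j
    · rw [if_pos hb, if_pos ((encodeGraph_getD_iff G i j).mpr hb)]
    · rw [if_neg hb, if_neg (by rwa [encodeGraph_getD_iff])]
  obtain ⟨hdata, h10⟩ := prepare_spec h3 hG M fun i => by rw [g1.arr 2 (by decide)]; rfl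
  have g2 := agree_denote prepare σ
  set τ := prepare.denote σ with hτ
  have hR' : ∀ v < n, R v = max (τ.arr 9 v) 1 := fun v hv => by
    rw [hdata.sz ⟨v, hv⟩]; exact hR ⟨v, hv⟩
  have hd0 : ∀ v, τ.arr 10 v = 0 := fun v => by
    rw [g2.arr 10 (by decide), g1.arr 10 (by decide), initState_arr_zero _ (by simp [hinp])]
  have hprod : ∏ u ∈ Finset.range n, R u = ∏ u ∈ Finset.range n, max (τ.arr 9 u) 1 :=
    Finset.prod_congr rfl fun u hu => hR' u (Finset.mem_range.mp hu)
  have hval0 : radixValue (fun v => max (τ.arr 9 v) 1) (τ.arr 10) n = 0 := by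
    simp [radixValue, hd0]
  have hval : ∀ d, radixValue R d n = radixValue (fun v => max (τ.arr 9 v) 1) d n := by
    exact fun d => radixValue_congr_radix hR'
  obtain ⟨υ, tr, ds, x1, x2, x3, x4, x5, x6⟩ := enumerate_spec (Nat.le_mul_self n)
    -- This constant covers both kinds of silent prefix: the preparations before the first round and
    -- the increment between rounds.
    (A := size.time.eval (n * n) + prepare.time.eval (n * n) + advance.time.eval (n * n))
    (by omega) (∏ u ∈ Finset.range n, max (τ.arr 9 u) 1) τ hdata
    (by rw [g2.reg 0 (by decide), h0]) (fun v => rfl)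
    (fun v _ => by rw [hd0]; exact lt_max_of_lt_right one_pos) h10
    (by rw [g2.buf (by decide), g1.buf (by decide)]; rfl) (by rw [hval0, zero_add])
  refine ⟨t1 ++ (t2 ++ tr), ds, ⟨υ, e1.seq (e2.seq x1)⟩, fun d hd v hv => ?_, ?_, ?_, ?_, ?_⟩
  · rw [hR' v hv]; exact x2 d hd v hv
  · simp_rw [hval]
    rw [x3, hval0, hprod, List.range_eq_range']
  · rw [outputs_append, outputs_append, outputs_of_silent s1, outputs_of_silent s2, x4]
    rfl
  · rw [hprod]
    simp only [liftingDelay, Polynomial.eval_add, List.length_append, Polynomial.eval_ofNat]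
    rw [Nat.succ_mul]
    omega
  · rw [← List.append_assoc]
    have := x6 (t1 ++ t2) (by simp; omega)
    intro pre mid post he hm
    have h := this pre mid post he hm
    simp only [liftingDelay, Polynomial.eval_add, Polynomial.eval_ofNat]
    omega
/-! ### Digits and choices -/

section Fibers

variable {n : ℕ} {f : Fin n → Fin n}

theorem fiberIndex_lt_fiberIndex {u v : Fin n} (huv : u < v) (h : f u = f v) :
    fiberIndex f u < fiberIndex f v := by
  classical
  refine Finset.card_lt_card ?_
  rw [Finset.ssubset_iff_of_subset]
  · exact ⟨u, by simp [huv, h], by simp⟩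
  · intro w
    simp only [Finset.mem_filter, Finset.mem_univ, true_and]
    exact fun hw => ⟨hw.1.trans huv, hw.2.trans h⟩

theorem eq_of_fiberIndex_eq {u v : Fin n} (h : f u = f v) (hi : fiberIndex f u = fiberIndex f v) :
    u = v := by
  rcases lt_trichotomy u v with hlt | rfl | hlt
  · exact absurd hi (fiberIndex_lt_fiberIndex hlt h).ne
  · rfl
  · exact absurd hi (fiberIndex_lt_fiberIndex hlt h.symm).ne'

theorem fiberIndex_lt (u : Fin n) : fiberIndex f u < fiberSize f (f u) := by
  classical
  refine Finset.card_lt_card ?_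
  rw [Finset.ssubset_iff_of_subset]
  · exact ⟨u, by simp, by simp⟩
  · intro w
    simp only [Finset.mem_filter, Finset.mem_univ, true_and]
    exact And.right

/-- Indices are distinct within a fiber and smaller than its size, so by counting they exhaust the
range. -/
theorem exists_fiberIndex_eq {v : Fin n} {k : ℕ} (hk : k < fiberSize f v) :
    ∃ u, f u = v ∧ fiberIndex f u = k := by
  classical
  set S := Finset.univ.filter fun u => f u = v with hS
  have hsub : S.image (fiberIndex f) ⊆ Finset.range (fiberSize f v) := by
    intro k hk
    obtain ⟨u, hu, rfl⟩ := Finset.mem_image.mp hk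
    simp only [hS, Finset.mem_filter, Finset.mem_univ, true_and] at hu
    rw [← hu]
    exact Finset.mem_range.mpr (fiberIndex_lt u)
  have hcard : (S.image (fiberIndex f)).card = fiberSize f v := by
    rw [Finset.card_image_of_injOn]
    · rfl
    · intro a ha b hb hab
      simp only [hS, Finset.coe_filter, Finset.mem_univ, true_and, Set.mem_ofPred_eq] at ha hb
      exact eq_of_fiberIndex_eq (ha.trans hb.symm) hab
  have := Finset.eq_of_subset_of_card_le hsub (by simp [hcard])
  have hk' : k ∈ S.image (fiberIndex f) := this ▸ Finset.mem_range.mpr hk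
  obtain ⟨u, hu, rfl⟩ := Finset.mem_image.mp hk'
  simp only [hS, Finset.mem_filter, Finset.mem_univ, true_and] at hu
  exact ⟨u, hu, rfl⟩

end Fibers

section Digits

variable {n : ℕ} {G : SimpleGraph (Fin n)} {M : Set (Sym2 (Fin (keptList G).length))}

/-- The image of a set of edges of the kernel in the graph. -/
def keepCut (G : SimpleGraph (Fin n)) (M : Set (Sym2 (Fin (keptList G).length))) :
    Set (Sym2 (Fin n)) := Sym2.map (keep G) '' M

theorem incident_keepCut {a : Fin (keptList G).length} :
    Incident (keepCut G M) (keep G a) ↔ Incident M a := by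
  constructor
  · rintro ⟨w, hw⟩
    obtain ⟨b, rfl⟩ := (mem_range_of_mem_image_map hw).2
    exact ⟨b, (mem_image_map keep_injective).mp hw⟩
  · rintro ⟨b, hb⟩
    exact ⟨keep G b, (mem_image_map keep_injective).mpr hb⟩

/-- Over an incident vertex the fiber consists of all vertices that it represents. Elsewhere the
fibers of `activeRep` do not merge vertices, so that irrelevant choices do not produce the same lift
repeatedly. -/
theorem activeRep_eq_keep_iff {a : Fin (keptList G).length} (ha : Incident M a) {u : Fin n} :
    activeRep G (keepCut G M) u = keep G a ↔ rep G u = keep G a := by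
  unfold activeRep
  split_ifs with h
  · rfl
  · constructor
    · rintro rfl; exact isChoice_keep a
    · intro hu; rw [hu, incident_keepCut] at h; exact absurd ha h

/-- The lifted cut is determined by the vertices with the given positions in their fibers. -/
theorem cutWord_eq {c : Fin (keptList G).length → Fin n} (hc : IsChoice G c) {d : ℕ → ℕ}
    (hd : ∀ a, Incident M a → d (keep G a) = fiberIndex (activeRep G (keepCut G M)) (c a)) :
    cutWord (fun i j => s(i, j) ∈ keepCut G M) (activeRep G (keepCut G M))
      (fiberIndex (activeRep G (keepCut G M))) d = encodeEdges (Sym2.map c '' M) := by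
  classical
  have key : ∀ a, Incident M a → ∀ i, activeRep G (keepCut G M) i = keep G a →
      d (keep G a) = fiberIndex (activeRep G (keepCut G M)) i → i = c a := by
    intro a ha i hi hdi
    refine eq_of_fiberIndex_eq (f := activeRep G (keepCut G M)) ?_ (hdi.symm.trans (hd a ha))
    rw [hi, (activeRep_eq_keep_iff ha).mpr (hc a)]
  rw [cutWord, encodeEdges]
  congr 1
  funext i j
  rw [decide_eq_decide]
  constructor
  · rintro ⟨hm, hi, hj⟩
    obtain ⟨⟨a, ha⟩, ⟨b, hb⟩⟩ := mem_range_of_mem_image_map hm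
    rw [← ha, ← hb, keepCut, mem_image_map keep_injective] at hm
    rw [← ha] at hi
    rw [← hb] at hj
    rw [key a ⟨b, hm⟩ i ha.symm hi, key b ⟨a, Sym2.eq_swap ▸ hm⟩ j hb.symm hj,
      mem_image_map hc.injective]
    exact hm
  · intro hm
    obtain ⟨⟨a, rfl⟩, ⟨b, rfl⟩⟩ := mem_range_of_mem_image_map hm
    rw [mem_image_map hc.injective] at hm
    have ha : Incident M a := ⟨b, hm⟩
    have hb : Incident M b := ⟨a, Sym2.eq_swap ▸ hm⟩
    rw [(activeRep_eq_keep_iff ha).mpr (hc a), (activeRep_eq_keep_iff hb).mpr (hc b)]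
    exact ⟨(mem_image_map keep_injective).mpr hm, hd a ha, hd b hb⟩

variable {R : ℕ → ℕ}

theorem exists_choice_of_digits
    (hR : ∀ v : Fin n, R v = max (fiberSize (activeRep G (keepCut G M)) v) 1)
    {d : ℕ → ℕ} (hd : ∀ v < n, d v < R v) : ∃ c, IsChoice G c ∧
      ∀ a, Incident M a → d (keep G a) = fiberIndex (activeRep G (keepCut G M)) (c a) := by
  have ex : ∀ a, ∃ u, rep G u = keep G a ∧
      (Incident M a → d (keep G a) = fiberIndex (activeRep G (keepCut G M)) u) := by
    intro a
    by_cases ha : Incident M a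
    · have hpos : fiberIndex (activeRep G (keepCut G M)) (keep G a) <
          fiberSize (activeRep G (keepCut G M)) (keep G a) := by
        conv_rhs => rw [← (activeRep_eq_keep_iff ha).mpr (isChoice_keep a)]
        exact fiberIndex_lt _
      have hlt := hd (keep G a) (keep G a).2
      rw [hR] at hlt
      obtain ⟨u, hu, hi⟩ := exists_fiberIndex_eq (f := activeRep G (keepCut G M))
        (v := keep G a) (k := d (keep G a)) (by omega)
      exact ⟨u, (activeRep_eq_keep_iff ha).mp hu, fun _ => hi.symm⟩
    · exact ⟨keep G a, isChoice_keep a, fun h => absurd h ha⟩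
  choose c hc hc' using ex
  exact ⟨c, hc, hc'⟩

theorem exists_digits_of_choice
    (hR : ∀ v : Fin n, R v = max (fiberSize (activeRep G (keepCut G M)) v) 1)
    {c : Fin (keptList G).length → Fin n} (hc : IsChoice G c) : ∃ d : ℕ → ℕ,
      (∀ v < n, d v < R v) ∧
      ∀ a, Incident M a → d (keep G a) = fiberIndex (activeRep G (keepCut G M)) (c a) := by
  classical
  -- Digits at vertices that are not incident with the cut have no effect; 0 is always admissible,
  -- since the radices are at least 1.
  refine ⟨fun v => if h : ∃ a, (keep G a : ℕ) = v ∧ Incident M a then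
    fiberIndex (activeRep G (keepCut G M)) (c h.choose) else 0, fun v hv => ?_, fun a ha => ?_⟩
  · change dite _ _ _ < _
    split_ifs with h
    · obtain ⟨h1, h2⟩ := h.choose_spec
      have := fiberIndex_lt (f := activeRep G (keepCut G M)) (c h.choose)
      rw [(activeRep_eq_keep_iff h2).mpr (hc _)] at this
      refine this.trans_le ((le_max_left _ 1).trans_eq ?_)
      rw [← hR, h1]
    · rw [show v = (⟨v, hv⟩ : Fin n).val from rfl, hR]
      exact lt_max_of_lt_right one_pos
  · have h : ∃ b, (keep G b : ℕ) = keep G a ∧ Incident M b := ⟨a, rfl, ha⟩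
    change dite _ _ _ = _
    rw [dif_pos h, keep_injective (Fin.ext h.choose_spec.1)]

/-- A vertex with a nontrivial fiber is incident with the cut and has two further twins. -/
theorem of_one_lt_fiberSize {v : Fin n} (hv : 1 < fiberSize (activeRep G (keepCut G M)) v) :
    (∃ a, keep G a = v ∧ Incident M a) ∧
      ∃ a b, v ≠ a ∧ v ≠ b ∧ a ≠ b ∧ Twin G v a ∧ Twin G v b := by
  classical
  obtain ⟨u, hu, huv⟩ := Finset.exists_mem_ne hv v
  simp only [Finset.mem_filter, Finset.mem_univ, true_and] at hu
  unfold activeRep at hu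
  split_ifs at hu with h
  · subst hu
    obtain ⟨a, ha⟩ := exists_keep (rank_rep_lt (G := G) u)
    rw [← ha, incident_keepCut] at h
    refine ⟨⟨a, ha, h⟩, ?_⟩
    -- Only vertices of rank two represent others, and those have twins of ranks 0 and 1.
    have hr : rank G (rep G u) = 2 := by
      rw [rank_rep]
      by_contra hlt
      exact huv (rep_of_rank_lt (by omega)).symm
    obtain ⟨x, hx, hxr⟩ := exists_twin_of_lt_rank (show 0 < rank G (rep G u) by omega)
    obtain ⟨y, hy, hyr⟩ := exists_twin_of_lt_rank (show 1 < rank G (rep G u) by omega)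
    refine ⟨x, y, ?_, ?_, ?_, hx, hy⟩
    · intro e; rw [← e] at hxr; omega
    · intro e; rw [← e] at hyr; omega
    · rintro rfl; omega
  · exact absurd hu huv

/-- A nontrivial fiber belongs to an incident vertex, so the lift contains an edge at the chosen
vertex of this fiber; applying `rep` to its ends shows that both choices pick the same vertex. All
other digits have radix 1. -/
theorem digits_eq_of_cutWord_eq
    (hR : ∀ v : Fin n, R v = max (fiberSize (activeRep G (keepCut G M)) v) 1)
    {d d' : ℕ → ℕ} (hd : ∀ v < n, d v < R v) (hd' : ∀ v < n, d' v < R v)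
    (h : cutWord (fun i j => s(i, j) ∈ keepCut G M) (activeRep G (keepCut G M))
        (fiberIndex (activeRep G (keepCut G M))) d =
      cutWord (fun i j => s(i, j) ∈ keepCut G M) (activeRep G (keepCut G M))
        (fiberIndex (activeRep G (keepCut G M))) d') : ∀ v < n, d v = d' v := by
  intro v hv
  by_cases hs : 1 < fiberSize (activeRep G (keepCut G M)) ⟨v, hv⟩
  · obtain ⟨⟨a, ha, b, hab⟩, -⟩ := of_one_lt_fiberSize hs
    obtain ⟨c, hc, hcd⟩ := exists_choice_of_digits hR hd
    obtain ⟨c', hc', hcd'⟩ := exists_choice_of_digits hR hd'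
    rw [cutWord_eq hc hcd, cutWord_eq hc' hcd'] at h
    have hm : s(c a, c b) ∈ Sym2.map c' '' M := by
      rw [← encodeEdges_injective h, mem_image_map hc.injective]; exact hab
    obtain ⟨a', ha'⟩ := (mem_range_of_mem_image_map hm).1
    have : a' = a := keep_injective (by rw [← hc' a', ha', hc a])
    subst this
    have e : (keep G a' : ℕ) = v := congrArg Fin.val ha
    rw [← e, hcd a' ⟨b, hab⟩, hcd' a' ⟨b, hab⟩, ha']
  · have h1 := hd v hv
    have h2 := hd' v hv
    rw [show v = (⟨v, hv⟩ : Fin n).val from rfl, hR] at h1 h2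
    simp only at h1 h2
    omega

/-- A minimal cut of the kernel has few liftings. -/
theorem prod_radices_le
    (hR : ∀ v : Fin n, R v = max (fiberSize (activeRep G (keepCut G M)) v) 1)
    (hM : IsMinimalMatchingCut (kernel G) M) : ∏ u ∈ Finset.range n, R u ≤ n + 1 := by
  have hM' : IsMinimalMatchingCut G (keepCut G M) :=
    isChoice_keep.isMinimalMatchingCut_image_iff.mpr hM
  have hle : ∀ v < n, R v ≤ n + 1 := by
    intro v hv
    have := hR ⟨v, hv⟩
    have h2 : fiberSize (activeRep G (keepCut G M)) ⟨v, hv⟩ ≤ n :=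
      (Finset.card_le_univ _).trans (by simp)
    simp only at this
    omega
  have huniq : ∀ v < n, R v ≠ 1 → ∀ w < n, R w ≠ 1 → v = w := by
    intro v hv hv1 w hw hw1
    have h1 := hR ⟨v, hv⟩
    have h2 := hR ⟨w, hw⟩
    simp only at h1 h2
    obtain ⟨⟨a, ha, hia⟩, ta⟩ := of_one_lt_fiberSize (G := G) (M := M) (v := ⟨v, hv⟩) (by omega)
    obtain ⟨⟨b, hb, hib⟩, tb⟩ := of_one_lt_fiberSize (G := G) (M := M) (v := ⟨w, hw⟩) (by omega)
    exact congrArg Fin.val (hM'.incident_unique ta tb (ha ▸ incident_keepCut.mpr hia)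
      (hb ▸ incident_keepCut.mpr hib))
  by_cases hex : ∃ v < n, R v ≠ 1
  · obtain ⟨v, hv, hv1⟩ := hex
    -- By `IsMinimalMatchingCut.incident_unique` at most one radix differs from 1, and it is bounded
    -- by the number of vertices.
    rw [Finset.prod_eq_single v]
    · exact hle v hv
    · intro w hw hne
      by_contra hw1
      exact hne (huniq w (Finset.mem_range.mp hw) hw1 v hv hv1)
    · intro h; exact absurd (Finset.mem_range.mpr hv) h
  · push Not at hex
    rw [Finset.prod_congr rfl fun v hv => hex v (Finset.mem_range.mp hv)]
    simp

/-- The solution-lifting algorithm lists the liftings of a cut of the kernel. -/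
theorem lifting_outputs (G : SimpleGraph (Fin n)) (M : Set (Sym2 (Fin (keptList G).length)))
    (y : List Bool) : ∃ tr, RunsWith lifting [encodeGraph G, y, encodeEdges M] tr ∧
      (outputs tr).Nodup ∧
      {w | w ∈ outputs tr} = {w | ∃ c, IsChoice G c ∧ w = encodeEdges (Sym2.map c '' M)} ∧
      DelayLE tr (liftingDelay.eval (n * n)) ∧
      (IsMinimalMatchingCut (kernel G) M →
        TimeLE tr ((n * n + 2) * liftingDelay.eval (n * n))) := by
  classical
  set R : ℕ → ℕ := fun v => if h : v < n then
    max (fiberSize (activeRep G (keepCut G M)) ⟨v, h⟩) 1 else 1 with hRdef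
  have hR : ∀ v : Fin n, R v = max (fiberSize (activeRep G (keepCut G M)) v) 1 := fun v => by
    rw [hRdef]; simp
  obtain ⟨tr, ds, h1, h2, h3, h4, h5, h6⟩ := lifting_spec G M y rfl hR
  change outputs tr = ds.map (cutWord (fun i j => s(i, j) ∈ keepCut G M)
    (activeRep G (keepCut G M)) (fiberIndex (activeRep G (keepCut G M)))) at h4
  refine ⟨tr, h1, ?_, ?_, h6, fun hM => ?_⟩
  -- The counter values are distinct, and equal words would force equal digits and hence equal
  -- values.
  · have hnd : (ds.map fun d => radixValue R d n).Nodup := h3 ▸ List.nodup_range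
    rw [h4]
    rw [List.Nodup, List.pairwise_map] at hnd ⊢
    refine hnd.imp_of_mem fun {d d'} hd hd' hne he => hne ?_
    exact radixValue_congr (digits_eq_of_cutWord_eq hR (h2 d hd) (h2 d' hd') he)
  · ext w
    simp only [Set.mem_ofPred_eq, h4, List.mem_map]
    constructor
    · rintro ⟨d, hd, rfl⟩
      obtain ⟨c, hc, hcd⟩ := exists_choice_of_digits hR (h2 d hd)
      exact ⟨c, hc, cutWord_eq hc hcd⟩
    · rintro ⟨c, hc, rfl⟩
      obtain ⟨d, hd, hcd⟩ := exists_digits_of_choice hR hc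
      have hmem : radixValue R d n ∈ ds.map fun d => radixValue R d n := by
        rw [h3, List.mem_range]; exact radixValue_lt hd
      obtain ⟨d', hd', he⟩ := List.mem_map.mp hmem
      have heq := eq_of_radixValue_eq (h2 d' hd') hd he
      exact ⟨d', hd', cutWord_eq hc fun a ha => by rw [heq _ (keep G a).2, hcd a ha]⟩
  -- There are at most `n + 1` lifts, and `n + 2 ≤ n * n + 2`; this form is a polynomial in the
  -- input length `n * n`.
  · refine h5.trans (Nat.mul_le_mul_right _ ?_)
    have := prod_radices_le hR hM
    have := Nat.le_mul_self n
    omega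

end Digits

/-! ### The kernels -/

theorem eval_mono (p : Polynomial ℕ) {a b : ℕ} (h : a ≤ b) : p.eval a ≤ p.eval b := by
  induction p using Polynomial.induction_on' with
  | add p q hp hq => simp only [Polynomial.eval_add]; exact Nat.add_le_add hp hq
  | monomial k c =>
    simp only [Polynomial.eval_monomial]
    exact Nat.mul_le_mul_left _ (Nat.pow_le_pow_left h _)

theorem graphSolutions_encodeGraph
    (IsSol : ∀ n, SimpleGraph (Fin n) → Set (Sym2 (Fin n)) → Prop) {n : ℕ}
    (G : SimpleGraph (Fin n)) :
    graphSolutions IsSol (encodeGraph G) = {w | ∃ M, IsSol n G M ∧ w = encodeEdges M} := by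
  ext w
  constructor
  · rintro ⟨m, H, M, he, hM, rfl⟩
    cases encodeGraph_injective he
    exact ⟨M, hM, rfl⟩
  · rintro ⟨M, hM, rfl⟩
    exact ⟨n, G, M, rfl, hM, rfl⟩

theorem kernelization_kernelVerticesLE : KernelVerticesLE kernelization (fun k => 3 * k) := by
  intro n G
  obtain ⟨y, tr, h1, h2, -, ⟨m, H, he, rfl⟩ | ⟨hne, -⟩⟩ := kernelization_spec (encodeGraph G)
  · cases encodeGraph_injective he
    exact ⟨_, kernel G, tr, h1, h2, length_keptList_le G⟩
  · exact absurd ⟨n, G, rfl⟩ hne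

theorem computable_kernelBound : Computable fun k : ℕ => 3 * k * (3 * k) + 3 * k := by
  have h : Primrec fun k : ℕ => 3 * k := Primrec.nat_mul.comp (Primrec.const 3) Primrec.id
  exact (Primrec.nat_add.comp (Primrec.nat_mul.comp h h) h).to_comp

theorem encodeGraph_empty (G : SimpleGraph (Fin 0)) : encodeGraph G = [] :=
  List.eq_nil_of_length_eq_zero (by rw [length_encodeGraph])

/-- The two algorithms are an enumeration kernel for every kind of matching cuts that is compatible
with choices. -/
theorem isEnumKernel_of_choice {Cost : Trace → ℕ → Prop}
    (IsSol : ∀ n, SimpleGraph (Fin n) → Set (Sym2 (Fin n)) → Prop)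
    (hsol : ∀ n G M, IsSol n G M → IsMatchingCut G M)
    (hchoice : ∀ n (G : SimpleGraph (Fin n)) c M, IsChoice G c →
      (IsSol n G (Sym2.map c '' M) ↔ IsSol _ (kernel G) M))
    (q : Polynomial ℕ)
    (hcost : ∀ n (G : SimpleGraph (Fin n)) M y tr t, IsSol _ (kernel G) M →
      RunsWith lifting [encodeGraph G, y, encodeEdges M] tr →
      DelayLE tr (liftingDelay.eval (n * n)) →
      (IsMinimalMatchingCut (kernel G) M → TimeLE tr ((n * n + 2) * liftingDelay.eval (n * n))) →
      n * n ≤ t → Cost tr (q.eval t)) :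
    IsEnumKernel Cost ⟨graphSolutions IsSol, graphSolutions_finite IsSol, ndParameter⟩
      kernelization lifting := by
  refine ⟨size.time + kernelize.time + 1, q, _, computable_kernelBound, fun x => ?_⟩
  obtain ⟨y, tr, h1, h2, h3, h4⟩ := kernelization_spec x
  refine ⟨y, ⟨tr, h1, h2, h3.trans (eval_mono _ (Nat.le_add_right _ _))⟩, ?_⟩
  rcases h4 with ⟨n, G, rfl, rfl⟩ | ⟨hne, rfl⟩
  · simp only [ndParameter_encodeGraph, length_encodeGraph, graphSolutions_encodeGraph]
    have hk := length_keptList_le G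
    refine ⟨Nat.add_le_add (Nat.mul_le_mul hk hk)
      ((neighborhoodDiversity_le (kernel G)).trans hk), ?_⟩
    refine ⟨fun s => {w | ∃ M c, s = encodeEdges M ∧ IsChoice G c ∧
      w = encodeEdges (Sym2.map c '' M)}, ?_, ?_, ?_, ?_⟩
    · rintro s ⟨M, hM, rfl⟩
      obtain ⟨tr, t1, t2, t3, t4, t5⟩ := lifting_outputs G M (encodeGraph (kernel G))
      refine ⟨tr, t1, hcost n G M _ tr _ hM t1 t4 t5 (by omega), t2, ?_⟩
      rw [t3]
      ext w
      constructor
      · rintro ⟨c, hc, rfl⟩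
        exact ⟨M, c, rfl, hc, rfl⟩
      · rintro ⟨M', c, he, hc, rfl⟩
        rw [encodeEdges_injective he]
        exact ⟨c, hc, rfl⟩
    · rintro s ⟨M, hM, rfl⟩
      exact ⟨_, M, keep G, rfl, isChoice_keep, rfl⟩
    · rintro s - s' - hne
      refine Set.disjoint_left.mpr ?_
      rintro w ⟨M, c, rfl, hc, rfl⟩ ⟨M', c', rfl, hc', he⟩
      refine hne ?_
      -- The representatives of a common lift give the image under `keep` of both cuts, and `keep`
      -- is injective.
      have := congrArg (Sym2.map (rep G) '' ·) (encodeEdges_injective he)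
      simp only [hc.image_rep, hc'.image_rep] at this
      rw [(Sym2.map.injective keep_injective).image_injective this]
    · ext w
      simp only [Set.mem_iUnion, Set.mem_ofPred_eq, exists_prop]
      constructor
      · rintro ⟨s, ⟨M, hM, rfl⟩, M', c, he, hc, rfl⟩
        rw [← encodeEdges_injective he]
        exact ⟨_, (hchoice n G c M hc).mpr hM, rfl⟩
      · rintro ⟨N, hN, rfl⟩
        obtain ⟨c, hc, M, rfl⟩ := (hsol n G N hN).exists_choice
        exact ⟨_, ⟨M, (hchoice n G c M hc).mp hN, rfl⟩, M, c, rfl, hc, rfl⟩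
  · have hx : graphSolutions IsSol x = ∅ := by
      ext w
      simp only [graphSolutions, Set.mem_ofPred_eq, Set.mem_empty_iff_false, iff_false]
      rintro ⟨n, G, M, rfl, -⟩
      exact hne ⟨n, G, rfl⟩
    -- The empty word encodes the graph without vertices, which has no partition into two nonempty
    -- sets.
    have hy : graphSolutions IsSol [] = ∅ := by
      rw [← encodeGraph_empty ⊥, graphSolutions_encodeGraph]
      ext w
      simp only [Set.mem_ofPred_eq, Set.mem_empty_iff_false, iff_false]
      rintro ⟨M, hM, -⟩
      obtain ⟨A, ⟨a, -⟩, -⟩ := isMatchingCut_iff.mp (hsol _ _ _ hM)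
      exact a.elim0
    have hκ : ndParameter [] = 0 := by
      rw [← encodeGraph_empty ⊥, ndParameter_encodeGraph]
      exact Nat.le_zero.mp (neighborhoodDiversity_le _)
    refine ⟨by simp [hκ], fun _ => ∅, ?_, ?_, ?_, ?_⟩
    · simp [hy]
    · simp [hy]
    · simp [hy]
    · simp [hx]

end EnumKernel

/-- The same two programs serve all three problems. For minimal cuts the total time is bounded by
the number of lifts times the delay bound, whence the factor `X + 2`. -/
theorem theorem4p3 :
    (∃ A A' : EnumKernel.Prog,
      EnumKernel.IsFullyPolynomialEnumKernel EnumKernel.enumMinimalMC A A' ∧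
      EnumKernel.KernelVerticesLE A (fun k => 3 * k)) ∧
    (∃ A A' : EnumKernel.Prog,
      EnumKernel.IsPolynomialDelayEnumKernel EnumKernel.enumMC A A' ∧
      EnumKernel.KernelVerticesLE A (fun k => 3 * k)) ∧
    (∃ A A' : EnumKernel.Prog,
      EnumKernel.IsPolynomialDelayEnumKernel EnumKernel.enumMaximalMC A A' ∧
      EnumKernel.KernelVerticesLE A (fun k => 3 * k)) := by
  have hdelay : ∀ {tr : EnumKernel.Trace} {s t : ℕ}, s ≤ t →
      EnumKernel.DelayLE tr (EnumKernel.liftingDelay.eval s) →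
      EnumKernel.DelayLE tr (EnumKernel.liftingDelay.eval t) :=
    fun hst h pre mid post he hm =>
      (h pre mid post he hm).trans (EnumKernel.eval_mono _ hst)
  refine ⟨⟨_, _, EnumKernel.isEnumKernel_of_choice
      (fun _ G M => EnumKernel.IsMinimalMatchingCut G M) (fun _ _ _ h => h.1)
      (fun _ _ _ _ hc => hc.isMinimalMatchingCut_image_iff)
      ((Polynomial.X + 2) * EnumKernel.liftingDelay) ?_,
      EnumKernel.kernelization_kernelVerticesLE⟩,
    ⟨_, _, EnumKernel.isEnumKernel_of_choice
      (fun _ G M => EnumKernel.IsMatchingCut G M) (fun _ _ _ h => h)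
      (fun _ _ _ _ hc => hc.isMatchingCut_image_iff)
      EnumKernel.liftingDelay (fun _ _ _ _ _ _ _ _ h _ ht => hdelay ht h),
      EnumKernel.kernelization_kernelVerticesLE⟩,
    ⟨_, _, EnumKernel.isEnumKernel_of_choice
      (fun _ G M => EnumKernel.IsMaximalMatchingCut G M) (fun _ _ _ h => h.1)
      (fun _ _ _ _ hc => hc.isMaximalMatchingCut_image_iff)
      EnumKernel.liftingDelay (fun _ _ _ _ _ _ _ _ h _ ht => hdelay ht h),
      EnumKernel.kernelization_kernelVerticesLE⟩⟩
  intro n G M y tr t hM _ _ htime ht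
  refine (htime hM).trans ?_
  simp only [Polynomial.eval_mul, Polynomial.eval_add, Polynomial.eval_X, Polynomial.eval_ofNat]
  exact Nat.mul_le_mul (by omega) (EnumKernel.eval_mono _ ht)
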